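/- Let $H^2$ be the Hardy space on the unit disc $\mathbb D$, $H^\infty$ the algebra of bounded analytic functions in $\mathbb D$, and $S$ the unilateral shift, that is, multiplication by the independent variable on $H^2$; for $g\in H^\infty$, $g(S)$ is multiplication by $g$ on $H^2$. For an inner function $\theta$ put $\mathcal K_\theta=H^2\ominus\theta H^2$ and $T_\theta=P_{\mathcal K_\theta}S|_{\mathcal K_\theta}$, and let $g(T_\theta)$ be understood in the sense of the $H^\infty$-functional calculus. All operators are linear and bounded, and $P_{\mathcal L}$ is the orthogonal projection onto $\mathcal L$. Theorem. Let $g,\eta,h,\theta,\omega\in H^\infty$, where $g\not\equiv 0$, $\theta$ and $\omega$ are inner, and $\omega=g\eta+\theta h$. Let $\mathcal H_0$ be a complex Hilbert space, and let $T_0\colon\mathcal H_0\to\mathcal H_0$, $X_0\colon\mathcal K_\theta\to\mathcal H_0$, $Y_0\colon\mathcal H_0\to\mathcal K_\theta$ be operators such that $$Y_0X_0=g(T_\theta),\qquad X_0T_\theta=T_0X_0,\qquad Y_0T_0=T_\theta Y_0.$$ With respect to the decomposition $H^2=\theta H^2\oplus\mathcal K_\theta$ define $X\colon H^2\to\theta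 H^2\oplus\mathcal H_0$, $Y\colon\theta H^2\oplus\mathcal H_0\to H^2$ and $T\colon\theta H^2\oplus\mathcal H_0\to\theta H^2\oplus\mathcal H_0$ by $$X=\begin{pmatrix} g(S)|_{\theta H^2} & P_{\theta H^2}g(S)|_{\mathcal K_\theta}\\ 0 & X_0\end{pmatrix},\qquad Y=I_{\theta H^2}\oplus Y_0,\qquad T=\begin{pmatrix} S|_{\theta H^2} & P_{\theta H^2}S|_{\mathcal K_\theta}Y_0\\ 0 & T_0\end{pmatrix},$$ and let $\mathcal M$ be the closure of $X\omega H^2$. Then $T\mathcal M\subset\mathcal M$; $T|_{\mathcal M}$ is similar to $S$, that is, there is a bounded, boundedly invertible operator $Z\colon\mathcal M\to H^2$ with $Z\,T|_{\mathcal M}=SZ$; and $Y\mathcal M=\vartheta\omega H^2$, where $\vartheta$ is the inner factor of $g$ (the inner function in the factorization of $g$ into an inner and an outer function). Moreover, $$XS=TX,\qquad YT=SY,\qquad YX=g(S).$$ -/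

import Mathlib

open Filter Topology Metric

noncomputable section

/-- The algebra `H^∞`: bounded analytic functions in the open unit disc. (The values of the
underlying function outside of the disc are irrelevant.) -/
structure HInf where
  toFun : ℂ → ℂ
  differentiableOn : DifferentiableOn ℂ toFun (ball 0 1)
  bounded : ∃ C : ℝ, ∀ z ∈ ball (0 : ℂ) 1, ‖toFun z‖ ≤ C

instance : CoeFun HInf (fun _ => ℂ → ℂ) := ⟨HInf.toFun⟩

instance : Mul HInf where
  mul g h :=
    { toFun := fun z => g z * h z
      differentiableOn := g.differentiableOn.mul h.differentiableOn
      bounded := by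
        obtain ⟨C, hC⟩ := g.bounded
        obtain ⟨D, hD⟩ := h.bounded
        refine ⟨C * D, fun z hz => ?_⟩
        rw [norm_mul]
        exact mul_le_mul (hC z hz) (hD z hz) (norm_nonneg _) ((norm_nonneg _).trans (hC z hz)) }

/-- The independent variable `z`, as an element of `H^∞`. -/
def HInf.var : HInf where
  toFun := fun z => z
  differentiableOn := differentiableOn_id
  bounded := ⟨1, fun z hz => by simpa using (mem_ball_zero_iff.1 hz).le⟩

/-- The Taylor series at `0` of `g ∈ H^∞`. -/
def HInf.taylor (g : HInf) : PowerSeries ℂ :=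
  PowerSeries.mk fun n => iteratedDeriv n g 0 / (n.factorial : ℂ)

/-- `θ ∈ H^∞` is inner: its radial boundary values have modulus `1` almost everywhere on the
unit circle. -/
def HInf.IsInner (θ : HInf) : Prop :=
  ∀ᵐ t : ℝ, Tendsto (fun r : ℝ => ‖θ (r * Complex.exp (t * Complex.I))‖) (𝓝[<] 1) (𝓝 1)

/-- `F ∈ H^∞` is outer: `F(z) = c exp (∫ (ζ + z) / (ζ - z) φ(ζ) dm(ζ))` with `|c| = 1` and a
real-valued `φ ∈ L¹(𝕋, m)`, where `m` is the normalized Lebesgue measure on the unit circle. -/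
def HInf.IsOuter (F : HInf) : Prop :=
  ∃ c : ℂ, ‖c‖ = 1 ∧ ∃ φ : ℂ → ℝ, CircleIntegrable φ 0 1 ∧ ∀ z ∈ ball (0 : ℂ) 1,
    F z = c * Complex.exp
      (Real.circleAverage (fun ζ => (ζ + z) / (ζ - z) * (φ ζ : ℂ)) 0 1)

/-- `ϑ` is the inner factor of `g` (it is unique up to a unimodular constant). -/
def HInf.IsInnerFactor (ϑ g : HInf) : Prop :=
  ϑ.IsInner ∧ ∃ F : HInf, F.IsOuter ∧ ∀ z ∈ ball (0 : ℂ) 1, g z = ϑ z * F z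

/-- The Hardy space `H²` on the unit disc: analytic functions `f(z) = ∑ aₙ zⁿ` with
`‖f‖² = ∑ |aₙ|² < ∞`. An element is stored as its sequence of Taylor coefficients, and
`H2.eval` is the corresponding function in the disc. -/
abbrev H2 : Type := lp (fun _ : ℕ => ℂ) 2

/-- The value `f(z)` of `f ∈ H²` at a point `z` of the unit disc. -/
def H2.eval (f : H2) (z : ℂ) : ℂ := ∑' n, f n * z ^ n

/-- The Taylor series at `0` of `f ∈ H²`. -/
def H2.taylor (f : H2) : PowerSeries ℂ := PowerSeries.mk fun n => f n

section Construction

theorem parseval_powerSeries {a : ℕ → ℂ} (ha : Summable fun n => ‖a n‖) :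
    HasSum (fun n => ‖a n‖ ^ 2)
      (Real.circleAverage (fun z => ‖∑' n, a n * z ^ n‖ ^ 2) 0 1) := by
  have : Fact (0 < 2 * Real.pi) := ⟨Real.two_pi_pos⟩
  set e : ℕ → C(AddCircle (2 * Real.pi), ℂ) := fun n => a n • fourier (n : ℤ) with he
  have hs : Summable e := by
    refine Summable.of_norm ?_
    simpa [he, norm_smul, fourier_norm] using ha
  set F := ∑' n, e n with hF
  set L := ContinuousMap.toLp (E := ℂ) 2 (AddCircle.haarAddCircle (T := 2 * Real.pi)) ℂ with hL
  have h1 : HasSum (fun n => a n • fourierLp (T := 2 * Real.pi) 2 (n : ℤ)) (L F) := by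
    have := hs.hasSum.mapL L
    simpa [he] using! this
  have hortho := orthonormal_fourier (T := 2 * Real.pi)
  have h2 : ∀ m : ℕ, inner ℂ (fourierLp (T := 2 * Real.pi) 2 (m : ℤ)) (L F) = a m := by
    intro m
    have h := h1.mapL (innerSL ℂ (fourierLp (T := 2 * Real.pi) 2 (m : ℤ)))
    refine h.unique ?_
    have h' : (fun n => (innerSL ℂ (fourierLp (T := 2 * Real.pi) 2 (m : ℤ)))
        (a n • fourierLp (T := 2 * Real.pi) 2 (n : ℤ))) = fun n => if n = m then a m else 0 := by
      ext n
      simp only [innerSL_apply_apply, inner_smul_right]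
      rw [orthonormal_iff_ite.1 hortho]
      by_cases hnm : n = m
      · simp [hnm]
      · simp [hnm, Ne.symm hnm]
    rw [h']
    exact hasSum_ite_eq m (a m)
  have h3 : HasSum (fun n => ((‖a n‖ ^ 2 : ℝ) : ℂ)) (inner ℂ (L F) (L F)) := by
    have h := h1.mapL (innerSL ℂ (L F))
    have h' : (fun n => (innerSL ℂ (L F)) (a n • fourierLp (T := 2 * Real.pi) 2 (n : ℤ))) =
        fun n => ((‖a n‖ ^ 2 : ℝ) : ℂ) := by
      ext n
      rw [innerSL_apply_apply, inner_smul_right, ← inner_conj_symm, h2]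
      rw [Complex.mul_conj, Complex.normSq_eq_norm_sq]
    rw [h'] at h
    exact h
  have h4 : inner ℂ (L F) (L F) = ((Real.circleAverage
      (fun z => ‖∑' n, a n * z ^ n‖ ^ 2) 0 1 : ℝ) : ℂ) := by
    rw [MeasureTheory.ContinuousMap.inner_toLp]
    have h5 : ∀ x, F x * (starRingEnd ℂ) (F x) = ((‖F x‖ ^ 2 : ℝ) : ℂ) := fun x => by
      rw [Complex.mul_conj, Complex.normSq_eq_norm_sq]
    simp_rw [h5]
    rw [integral_complex_ofReal]
    congr 1
    rw [AddCircle.integral_haarAddCircle, ← AddCircle.intervalIntegral_preimage (2 * Real.pi) 0,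
      Real.circleAverage_def, zero_add]
    congr 2
    ext t
    congr 2
    rw [hF, ← ContinuousMap.tsum_apply hs]
    congr 1
    ext n
    simp only [he, ContinuousMap.smul_apply, smul_eq_mul]
    rw [fourier_coe_apply]
    simp only [circleMap, zero_add, Complex.ofReal_one, one_mul, ← Complex.exp_nat_mul]
    congr 2
    have : (Real.pi : ℂ) ≠ 0 := by exact_mod_cast Real.pi_ne_zero
    push_cast
    field_simp
  rw [h4] at h3
  exact_mod_cast h3

theorem HInf.hasSum_taylor (g : HInf) {z : ℂ} (hz : ‖z‖ < 1) :
    HasSum (fun n => PowerSeries.coeff n g.taylor * z ^ n) (g z) := by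
  have := Complex.hasSum_taylorSeries_on_ball (c := 0) (r := 1) g.differentiableOn
    (z := z) (by simpa using hz)
  have h : (fun n : ℕ => ((n.factorial : ℂ)⁻¹ • (z - 0) ^ n • iteratedDeriv n g 0)) =
      fun n => PowerSeries.coeff n g.taylor * z ^ n := by
    ext n
    simp only [HInf.taylor, PowerSeries.coeff_mk, smul_eq_mul, sub_zero]
    ring
  rwa [h] at this

theorem HInf.summable_norm_taylor (g : HInf) {z : ℂ} (hz : ‖z‖ < 1) :
    Summable fun n => ‖PowerSeries.coeff n g.taylor * z ^ n‖ := by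
  exact (g.hasSum_taylor hz).summable.norm

theorem H2.summable_norm_taylor (f : H2) {z : ℂ} (hz : ‖z‖ < 1) :
    Summable fun n => ‖PowerSeries.coeff n f.taylor * z ^ n‖ := by
  refine Summable.of_nonneg_of_le (fun n => norm_nonneg _) (fun n => ?_)
    ((summable_geometric_of_lt_one (norm_nonneg z) hz).mul_left ‖f‖)
  rw [norm_mul, norm_pow]
  refine mul_le_mul_of_nonneg_right ?_ (by positivity)
  simpa [H2.taylor] using lp.norm_apply_le_norm (by norm_num) f n

theorem H2.hasSum_taylor (f : H2) {z : ℂ} (hz : ‖z‖ < 1) :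
    HasSum (fun n => PowerSeries.coeff n f.taylor * z ^ n) (f.eval z) := by
  have h := (f.summable_norm_taylor hz).of_norm.hasSum
  have h' : ∑' n, PowerSeries.coeff n f.taylor * z ^ n = f.eval z := by
    simp only [H2.eval, H2.taylor, PowerSeries.coeff_mk]
  rwa [h'] at h

theorem HInf.coeff_mul_pow (g : HInf) (f : H2) (z : ℂ) (n : ℕ) :
    PowerSeries.coeff n (g.taylor * f.taylor) * z ^ n =
      ∑ p ∈ Finset.HasAntidiagonal.antidiagonal n, (PowerSeries.coeff p.1 g.taylor * z ^ p.1) *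
        (PowerSeries.coeff p.2 f.taylor * z ^ p.2) := by
  rw [PowerSeries.coeff_mul, Finset.sum_mul]
  refine Finset.sum_congr rfl fun p hp => ?_
  rw [← Finset.HasAntidiagonal.mem_antidiagonal.1 hp, pow_add]
  ring

theorem HInf.summable_norm_mul (g : HInf) (f : H2) {z : ℂ} (hz : ‖z‖ < 1) :
    Summable fun n => ‖PowerSeries.coeff n (g.taylor * f.taylor) * z ^ n‖ := by
  have h1 := summable_norm_sum_mul_antidiagonal_of_summable_norm (g.summable_norm_taylor hz)
    (f.summable_norm_taylor hz)
  have h2 : (fun n => ‖∑ p ∈ Finset.HasAntidiagonal.antidiagonal n,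
      (PowerSeries.coeff p.1 g.taylor * z ^ p.1) * (PowerSeries.coeff p.2 f.taylor * z ^ p.2)‖) =
      fun n => ‖PowerSeries.coeff n (g.taylor * f.taylor) * z ^ n‖ :=
    funext fun n => congrArg norm (g.coeff_mul_pow f z n).symm
  rw [h2] at h1
  exact h1

theorem HInf.hasSum_mul (g : HInf) (f : H2) {z : ℂ} (hz : ‖z‖ < 1) :
    HasSum (fun n => PowerSeries.coeff n (g.taylor * f.taylor) * z ^ n) (g z * f.eval z) := by
  have h := (g.summable_norm_mul f hz).of_norm.hasSum
  have h1 := tsum_mul_tsum_eq_tsum_sum_antidiagonal_of_summable_norm (g.summable_norm_taylor hz)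
    (f.summable_norm_taylor hz)
  have h2 : (fun n => ∑ p ∈ Finset.HasAntidiagonal.antidiagonal n,
      (PowerSeries.coeff p.1 g.taylor * z ^ p.1) * (PowerSeries.coeff p.2 f.taylor * z ^ p.2)) =
      fun n => PowerSeries.coeff n (g.taylor * f.taylor) * z ^ n :=
    funext fun n => (g.coeff_mul_pow f z n).symm
  rw [(g.hasSum_taylor hz).tsum_eq, (f.hasSum_taylor hz).tsum_eq, h2] at h1
  rw [← h1] at h
  exact h

theorem H2.norm_sq (f : H2) : HasSum (fun n => ‖f n‖ ^ 2) (‖f‖ ^ 2) := by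
  have := lp.hasSum_norm (p := 2) (by norm_num) f
  simpa using this

/-- The mean of `|f|²` over the circle of radius `r`. -/
theorem H2.hasSum_circleAverage (f : H2) {r : ℝ} (h0 : 0 ≤ r) (h1 : r < 1) :
    HasSum (fun n => ‖f n‖ ^ 2 * (r ^ 2) ^ n)
      (Real.circleAverage (fun z => ‖f.eval (r * z)‖ ^ 2) 0 1) := by
  have hr : ‖(r : ℂ)‖ < 1 := by simpa [abs_of_nonneg h0] using h1
  have h := parseval_powerSeries (f.summable_norm_taylor hr)
  convert h using 2 with n
  · simp only [H2.taylor, PowerSeries.coeff_mk, norm_mul, norm_pow, Complex.norm_real,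
      Real.norm_eq_abs, abs_of_nonneg h0]
    ring
  · ext z
    simp [H2.eval, H2.taylor, mul_pow, mul_assoc]

/-- The mean of `|g f|²` over the circle of radius `r`. -/
theorem HInf.hasSum_circleAverage (g : HInf) (f : H2) {r : ℝ} (h0 : 0 ≤ r) (h1 : r < 1) :
    HasSum (fun n => ‖PowerSeries.coeff n (g.taylor * f.taylor)‖ ^ 2 * (r ^ 2) ^ n)
      (Real.circleAverage (fun z => ‖g (r * z) * f.eval (r * z)‖ ^ 2) 0 1) := by
  have hr : ‖(r : ℂ)‖ < 1 := by simpa [abs_of_nonneg h0] using h1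
  have h := parseval_powerSeries (g.summable_norm_mul f hr)
  convert h using 1
  · ext n
    simp only [norm_mul, norm_pow, Complex.norm_real,
      Real.norm_eq_abs, abs_of_nonneg h0]
    ring
  · refine Real.circleAverage_congr_sphere fun z hz => ?_
    have hz' : ‖z‖ = 1 := by simpa using hz
    have hrz : ‖(r : ℂ) * z‖ < 1 := by rw [norm_mul, hz', mul_one]; exact hr
    rw [← (g.hasSum_mul f hrz).tsum_eq]
    simp [mul_pow, mul_assoc]

theorem H2.continuousOn_eval (f : H2) : ContinuousOn f.eval (ball 0 1) := by
  refine continuousOn_of_forall_continuousAt fun z hz => ?_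
  obtain ⟨s, hs1, hs2⟩ := exists_between (mem_ball_zero_iff.1 hz)
  have hs0 : 0 ≤ s := (norm_nonneg z).trans hs1.le
  have hsn : ‖(s : ℂ)‖ < 1 := by simpa [abs_of_nonneg hs0] using hs2
  have hc : ContinuousOn (fun z => ∑' n, f n * z ^ n) (ball 0 s) := by
    refine continuousOn_tsum (u := fun n => ‖PowerSeries.coeff n f.taylor * (s : ℂ) ^ n‖)
      (fun n => by fun_prop) (f.summable_norm_taylor hsn) fun n w hw => ?_
    simp only [H2.taylor, PowerSeries.coeff_mk, norm_mul, norm_pow, Complex.norm_real,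
      Real.norm_eq_abs, abs_of_nonneg hs0]
    have : ‖w‖ ≤ s := (mem_ball_zero_iff.1 hw).le
    gcongr
  exact hc.continuousAt (isOpen_ball.mem_nhds (by simpa using hs1))

theorem mapsTo_real_mul_sphere {r : ℝ} (h0 : 0 ≤ r) (h1 : r < 1) :
    Set.MapsTo (fun z : ℂ => (r : ℂ) * z) (sphere 0 |1|) (ball 0 1) := by
  intro z hz
  have hz' : ‖z‖ = 1 := by simpa using hz
  simp [hz', abs_of_nonneg h0, h1]

theorem H2.continuousOn_sphere (f : H2) {r : ℝ} (h0 : 0 ≤ r) (h1 : r < 1) :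
    ContinuousOn (fun z : ℂ => f.eval (r * z)) (sphere 0 |1|) :=
  f.continuousOn_eval.comp (by fun_prop) (mapsTo_real_mul_sphere h0 h1)

theorem HInf.continuousOn_sphere (g : HInf) {r : ℝ} (h0 : 0 ≤ r) (h1 : r < 1) :
    ContinuousOn (fun z : ℂ => g (r * z)) (sphere 0 |1|) :=
  g.differentiableOn.continuousOn.comp (by fun_prop) (mapsTo_real_mul_sphere h0 h1)

theorem HInf.sum_coeff_sq_le (g : HInf) {C : ℝ} (hC : ∀ z ∈ ball (0 : ℂ) 1, ‖g z‖ ≤ C)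
    (f : H2) (s : Finset ℕ) :
    ∑ n ∈ s, ‖PowerSeries.coeff n (g.taylor * f.taylor)‖ ^ 2 ≤ C ^ 2 * ‖f‖ ^ 2 := by
  have key : ∀ r : ℝ, 0 ≤ r → r < 1 →
      ∑ n ∈ s, ‖PowerSeries.coeff n (g.taylor * f.taylor)‖ ^ 2 * (r ^ 2) ^ n ≤
        C ^ 2 * ‖f‖ ^ 2 := by
    intro r h0 h1
    have hC2 : (0 : ℝ) ≤ C ^ 2 := sq_nonneg C
    calc _ ≤ Real.circleAverage (fun z => ‖g (r * z) * f.eval (r * z)‖ ^ 2) 0 1 :=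
          sum_le_hasSum s (fun n _ => by positivity) (g.hasSum_circleAverage f h0 h1)
      _ ≤ Real.circleAverage (fun z => C ^ 2 • ‖f.eval (r * z)‖ ^ 2) 0 1 := by
          refine Real.circleAverage_mono ?_ ?_ ?_
          · exact ContinuousOn.circleIntegrable' (((g.continuousOn_sphere h0 h1).mul
              (f.continuousOn_sphere h0 h1)).norm.pow 2)
          · exact ContinuousOn.circleIntegrable'
              (continuousOn_const.mul ((f.continuousOn_sphere h0 h1).norm.pow 2))
          · intro z hz
            have := hC _ (mapsTo_real_mul_sphere h0 h1 hz)
            simp only [norm_mul, mul_pow, smul_eq_mul]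
            gcongr
      _ = C ^ 2 * Real.circleAverage (fun z => ‖f.eval (r * z)‖ ^ 2) 0 1 := by
          rw [Real.circleAverage_fun_smul, smul_eq_mul]
      _ ≤ C ^ 2 * ‖f‖ ^ 2 := by
          refine mul_le_mul_of_nonneg_left ?_ hC2
          refine hasSum_le (fun n => ?_) (f.hasSum_circleAverage h0 h1) f.norm_sq
          refine mul_le_of_le_one_right (by positivity) (pow_le_one₀ (by positivity) ?_)
          exact pow_le_one₀ h0 h1.le
  have hlim : Tendsto (fun r : ℝ => ∑ n ∈ s,
      ‖PowerSeries.coeff n (g.taylor * f.taylor)‖ ^ 2 * (r ^ 2) ^ n) (𝓝[<] 1)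
      (𝓝 (∑ n ∈ s, ‖PowerSeries.coeff n (g.taylor * f.taylor)‖ ^ 2)) := by
    have hc : Continuous (fun r : ℝ => ∑ n ∈ s,
      ‖PowerSeries.coeff n (g.taylor * f.taylor)‖ ^ 2 * (r ^ 2) ^ n) := by fun_prop
    have := hc.tendsto 1
    simp only [one_pow, mul_one] at this
    exact this.mono_left nhdsWithin_le_nhds
  refine le_of_tendsto hlim ?_
  filter_upwards [Ioo_mem_nhdsLT (show (0 : ℝ) < 1 by norm_num)] with r hr
  exact key r hr.1.le hr.2

theorem HInf.memlp_mul (g : HInf) (f : H2) :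
    Memℓp (E := fun _ : ℕ => ℂ) (fun n => PowerSeries.coeff n (g.taylor * f.taylor)) 2 := by
  obtain ⟨C, hC⟩ := g.bounded
  refine memℓp_gen' (C := C ^ 2 * ‖f‖ ^ 2) fun s => ?_
  simpa using g.sum_coeff_sq_le hC f s

end Construction

/-- Multiplication by `g ∈ H^∞` on `H²`, that is, the operator `g(S)`. The Taylor series of `g f`
is the product of those of `g` and `f`; see also `HInf.eval_mulOp`. -/
def HInf.mulOp (g : HInf) : H2 →L[ℂ] H2 :=
  LinearMap.mkContinuousOfExistsBound
    { toFun := fun f => ⟨fun n => PowerSeries.coeff n (g.taylor * f.taylor), g.memlp_mul f⟩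
      map_add' := fun f₁ f₂ => by
        have : (f₁ + f₂).taylor = f₁.taylor + f₂.taylor := by
          ext n; simp [H2.taylor]
        ext n
        simp only [this, mul_add, map_add]
        rfl
      map_smul' := fun c f => by
        have : (c • f).taylor = c • f.taylor := by
          ext n; simp [H2.taylor]
        ext n
        simp only [this, mul_smul_comm, map_smul]
        rfl }
    (by
      obtain ⟨C, hC⟩ := g.bounded
      refine ⟨C, fun f => ?_⟩
      have h0 : 0 ≤ C := (norm_nonneg _).trans (hC 0 (by simp))
      refine lp.norm_le_of_forall_sum_le (by norm_num) (by positivity) fun s => ?_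
      simpa [mul_pow] using g.sum_coeff_sq_le hC f s)

theorem HInf.mulOp_apply (g : HInf) (f : H2) (n : ℕ) :
    g.mulOp f n = PowerSeries.coeff n (g.taylor * f.taylor) := rfl

theorem HInf.taylor_mulOp (g : HInf) (f : H2) : (g.mulOp f).taylor = g.taylor * f.taylor := by
  ext n
  simp [H2.taylor, HInf.mulOp_apply]

theorem HInf.eval_mulOp (g : HInf) (f : H2) {z : ℂ} (hz : z ∈ ball (0 : ℂ) 1) :
    (g.mulOp f).eval z = g z * f.eval z :=
  (g.hasSum_mul f (mem_ball_zero_iff.1 hz)).tsum_eq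

theorem HInf.mulOp_comm (g h : HInf) (f : H2) : g.mulOp (h.mulOp f) = h.mulOp (g.mulOp f) := by
  ext n
  rw [HInf.mulOp_apply, HInf.mulOp_apply, HInf.taylor_mulOp, HInf.taylor_mulOp, mul_left_comm]

/-- The unilateral shift `S`: multiplication by the independent variable on `H²`. -/
def shift : H2 →L[ℂ] H2 := HInf.var.mulOp

/-- The subspace `θ H²` of `H²`. -/
def HInf.range (θ : HInf) : Submodule ℂ H2 := LinearMap.range θ.mulOp.toLinearMap

theorem HInf.mulOp_mem_range (g θ : HInf) : ∀ f ∈ θ.range, g.mulOp f ∈ θ.range := by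
  rintro _ ⟨f, rfl⟩
  exact ⟨g.mulOp f, g.mulOp_comm θ f ▸ rfl⟩

theorem HInf.IsInner.norm_le_of_finite {θ : HInf} (hθ : θ.IsInner) (f : H2) (s : Finset ℕ)
    (hs : ∀ n ∉ s, f n = 0) : ‖f‖ ≤ ‖θ.mulOp f‖ := by
  have hev : ∀ z, f.eval z = ∑ n ∈ s, f n * z ^ n := fun z =>
    tsum_eq_sum fun n hn => by simp [hs n hn]
  have hcont : Continuous f.eval := by
    have : f.eval = fun z => ∑ n ∈ s, f n * z ^ n := funext hev
    rw [this]; fun_prop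
  have hsum : Summable fun n => ‖f n‖ :=
    summable_of_ne_finset_zero (s := s) fun n hn => by simp [hs n hn]
  have hnorm : Real.circleAverage (fun z => ‖f.eval z‖ ^ 2) 0 1 = ‖f‖ ^ 2 :=
    (parseval_powerSeries hsum).unique f.norm_sq
  obtain ⟨C, hC⟩ := θ.bounded
  have hlim : Tendsto
      (fun r : ℝ => Real.circleAverage (fun z => ‖θ (r * z) * f.eval (r * z)‖ ^ 2) 0 1)
      (𝓝[<] 1) (𝓝 (‖f‖ ^ 2)) := by
    rw [← hnorm]
    simp only [Real.circleAverage_def]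
    refine Tendsto.const_smul ?_ _
    obtain ⟨B, hB⟩ := (isCompact_closedBall (0 : ℂ) 1).exists_bound_of_continuousOn
      hcont.continuousOn
    have hball : ∀ r : ℝ, r ∈ Set.Ioo (0 : ℝ) 1 → ∀ t, (r : ℂ) * circleMap 0 1 t ∈ ball (0 : ℂ) 1 :=
      fun r hr t => mapsTo_real_mul_sphere hr.1.le hr.2 (by simp)
    refine intervalIntegral.tendsto_integral_filter_of_dominated_convergence
      (fun _ => (C * B) ^ 2) ?_ ?_ (by simp) ?_
    · filter_upwards [Ioo_mem_nhdsLT (show (0 : ℝ) < 1 by norm_num)] with r hr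
      have h1 : Continuous fun t => θ ((r : ℂ) * circleMap 0 1 t) :=
        θ.differentiableOn.continuousOn.comp_continuous (by fun_prop) (hball r hr)
      have h2 : Continuous fun t => f.eval ((r : ℂ) * circleMap 0 1 t) :=
        hcont.comp (by fun_prop)
      exact ((h1.mul h2).norm.pow 2).aestronglyMeasurable
    · filter_upwards [Ioo_mem_nhdsLT (show (0 : ℝ) < 1 by norm_num)] with r hr
      refine Eventually.of_forall fun t _ => ?_
      have h1 := hC _ (hball r hr t)
      have h2 := hB _ (ball_subset_closedBall (hball r hr t))
      rw [norm_pow, norm_norm, norm_mul]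
      gcongr
      exact (norm_nonneg _).trans h1
    · filter_upwards [hθ] with t ht _
      have h2 : Tendsto (fun r : ℝ => ‖f.eval ((r : ℂ) * circleMap 0 1 t)‖) (𝓝[<] 1)
          (𝓝 ‖f.eval (circleMap 0 1 t)‖) := by
        have hc : Continuous fun r : ℝ => ‖f.eval ((r : ℂ) * circleMap 0 1 t)‖ :=
          (hcont.comp (by fun_prop)).norm
        have := hc.tendsto 1
        simp only [Complex.ofReal_one, one_mul] at this
        exact this.mono_left nhdsWithin_le_nhds
      have h3 := (ht.mul h2).pow 2
      simp only [one_mul] at h3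
      simpa [circleMap] using h3
  have hle : ‖f‖ ^ 2 ≤ ‖θ.mulOp f‖ ^ 2 := by
    refine le_of_tendsto hlim ?_
    filter_upwards [Ioo_mem_nhdsLT (show (0 : ℝ) < 1 by norm_num)] with r hr
    refine hasSum_le (fun n => ?_) (θ.hasSum_circleAverage f hr.1.le hr.2) (θ.mulOp f).norm_sq
    refine mul_le_of_le_one_right (by positivity) (pow_le_one₀ (by positivity) ?_)
    exact pow_le_one₀ hr.1.le hr.2.le
  exact le_of_sq_le_sq hle (norm_nonneg _)

theorem HInf.IsInner.norm_le {θ : HInf} (hθ : θ.IsInner) (f : H2) : ‖f‖ ≤ ‖θ.mulOp f‖ := by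
  have h := lp.hasSum_single (E := fun _ : ℕ => ℂ) (p := 2) (by norm_num) f
  refine le_of_tendsto_of_tendsto' h.norm ((θ.mulOp.continuous.tendsto f).comp h).norm fun s => ?_
  refine hθ.norm_le_of_finite _ s fun n hn => ?_
  simp only [lp.coeFn_sum, Finset.sum_apply]
  refine Finset.sum_eq_zero fun m hm => ?_
  have : n ≠ m := fun h => hn (h ▸ hm)
  exact lp.single_apply_ne _ _ _ this

theorem HInf.IsInner.isClosed_range {θ : HInf} (hθ : θ.IsInner) : IsClosed (θ.range : Set H2) := by
  have : AntilipschitzWith 1 θ.mulOp :=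
    AddMonoidHomClass.antilipschitz_of_bound _ fun f => by simpa using hθ.norm_le f
  exact this.isClosed_range θ.mulOp.uniformContinuous

theorem HInf.IsInner.hasOrthogonalProjection {θ : HInf} (hθ : θ.IsInner) :
    θ.range.HasOrthogonalProjection := by
  have : CompleteSpace θ.range := hθ.isClosed_range.completeSpace_coe
  infer_instance

/-- The orthogonal projection `P_{θ H²}` of `H²` onto `θ H²`. -/
def HInf.IsInner.projRange {θ : HInf} (hθ : θ.IsInner) : H2 →L[ℂ] θ.range :=
  haveI := hθ.hasOrthogonalProjection
  θ.range.orthogonalProjectionOnto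

/-- The model space `K_θ = H² ⊖ θ H²`. -/
abbrev HInf.model (θ : HInf) : Submodule ℂ H2 := θ.rangeᗮ

/-- The orthogonal projection `P_{K_θ}` of `H²` onto `K_θ`. -/
def HInf.projModel (θ : HInf) : H2 →L[ℂ] θ.model := θ.model.orthogonalProjectionOnto

/-- The model operator `T_θ = P_{K_θ} S|_{K_θ}`. -/
def HInf.modelOp (θ : HInf) : θ.model →L[ℂ] θ.model :=
  θ.projModel ∘L shift ∘L θ.model.subtypeL

/-- `A = g(T)` in the sense of the `H^∞`-functional calculus: if `g(z) = ∑ cₙ zⁿ`, then the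
operators `g_r(T) = ∑ cₙ rⁿ Tⁿ`, `0 < r < 1`, converge to `A` in the strong operator topology as
`r → 1`. -/
def IsHInfCalculus {H : Type*} [NormedAddCommGroup H] [InnerProductSpace ℂ H]
    (g : HInf) (T A : H →L[ℂ] H) : Prop :=
  (∀ r ∈ Set.Ioo (0 : ℝ) 1,
    Summable fun n => (PowerSeries.coeff n g.taylor * (r : ℂ) ^ n) • T ^ n) ∧
  ∀ x : H, Tendsto
    (fun r : ℝ => (∑' n, (PowerSeries.coeff n g.taylor * (r : ℂ) ^ n) • T ^ n) x)
    (𝓝[<] 1) (𝓝 (A x))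

/-- Similarity `T ≈ R` of two operators. -/
def OpSimilar {H K : Type*} [TopologicalSpace H] [AddCommMonoid H] [Module ℂ H]
    [TopologicalSpace K] [AddCommMonoid K] [Module ℂ K] (T : H →L[ℂ] H) (R : K →L[ℂ] K) : Prop :=
  ∃ Z : H ≃L[ℂ] K, ∀ x : H, Z (T x) = R (Z x)

section Operators

variable {H₀ : Type*} [NormedAddCommGroup H₀] [InnerProductSpace ℂ H₀]

/-- The Hilbert space `θ H² ⊕ H₀`. -/
abbrev DirectSumSpace (θ : HInf) (H₀ : Type*) [NormedAddCommGroup H₀] [InnerProductSpace ℂ H₀] :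
    Type _ :=
  WithLp 2 (θ.range × H₀)

/-- The operator `X : H² = θ H² ⊕ K_θ → θ H² ⊕ H₀` given by the matrix
`(g(S)|_{θ H²}, P_{θ H²} g(S)|_{K_θ}; 0, X₀)`. -/
def opX (g : HInf) {θ : HInf} (hθ : θ.IsInner) (X₀ : θ.model →L[ℂ] H₀) :
    H2 →L[ℂ] DirectSumSpace θ H₀ :=
  (WithLp.prodContinuousLinearEquiv 2 ℂ θ.range H₀).symm.toContinuousLinearMap ∘L
    ((g.mulOp.restrict (g.mulOp_mem_range θ) ∘L hθ.projRange +
        hθ.projRange ∘L g.mulOp ∘L θ.model.subtypeL ∘L θ.projModel).prod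
      (X₀ ∘L θ.projModel))

/-- The operator `Y = I ⊕ Y₀ : θ H² ⊕ H₀ → θ H² ⊕ K_θ = H²`. -/
def opY (θ : HInf) (Y₀ : H₀ →L[ℂ] θ.model) : DirectSumSpace θ H₀ →L[ℂ] H2 :=
  θ.range.subtypeL ∘L WithLp.fstL 2 ℂ θ.range H₀ +
    θ.model.subtypeL ∘L Y₀ ∘L WithLp.sndL 2 ℂ θ.range H₀

/-- The operator `T : θ H² ⊕ H₀ → θ H² ⊕ H₀` given by the matrix
`(S|_{θ H²}, P_{θ H²} S|_{K_θ} Y₀; 0, T₀)`. -/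
def opT {θ : HInf} (hθ : θ.IsInner) (T₀ : H₀ →L[ℂ] H₀) (Y₀ : H₀ →L[ℂ] θ.model) :
    DirectSumSpace θ H₀ →L[ℂ] DirectSumSpace θ H₀ :=
  (WithLp.prodContinuousLinearEquiv 2 ℂ θ.range H₀).symm.toContinuousLinearMap ∘L
    ((shift.restrict (HInf.var.mulOp_mem_range θ) ∘L WithLp.fstL 2 ℂ θ.range H₀ +
        hθ.projRange ∘L shift ∘L θ.model.subtypeL ∘L Y₀ ∘L WithLp.sndL 2 ℂ θ.range H₀).prod
      (T₀ ∘L WithLp.sndL 2 ℂ θ.range H₀))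

end Operators

end

/-! The operator `Y` intertwines `T` with `S`, and `YX = g(S)`, so `Y` carries `XωH²` onto `gωH²`.
Everything therefore rests on `Y` being bounded below on `XωH²`, and this is where `ω = gη + θh`
enters. It splits `Xωf` into `Xη(gf)` and `Xθ(hf)`. The first term is at most a constant times
`‖gf‖`. On `θH²` the operator `X` is multiplication by `g`, so the second term has norm `‖θh(gf)‖`,
again at most a constant times `‖gf‖`. On the other side `YXωf = ωgf`, and `‖gf‖ ≤ ‖ωgf‖` because
`ω` is inner (`exists_norm_opX_le`).

Hence `Y` maps `M` isomorphically onto the closure of `gωH²` (`map_topologicalClosure_eq`,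
`exists_equiv_of_norm_le`), and `T` on `M` is similar to the restriction of `S` to that closure. A
Wold-type argument (`HInf.exists_hilbertBasis_closure_range`) shows that this restriction is
unitarily equivalent to `S` as soon as `gω` is not zero; no factorization of `g` is needed here.
When `g = ϑF` with `F` outer, `F` is cyclic for `S` (`HInf.IsOuter.closure_range_eq_top`), so the
closure of `gωH²` is `ϑωH²`.

The intertwining relations follow from the invariance of `θH²` under multiplications, together with
the identity `g(T_θ)P = P g(S)`, where `P` is the projection onto `K_θ`
(`HInf.IsInner.eq_of_isHInfCalculus`). -/

noncomputable section

/-! ### The Taylor coefficients of `H²` and `H^∞` functions -/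

theorem coeff_eq_of_hasSum_ball {a b : ℕ → ℂ} {f : ℂ → ℂ}
    (ha : ∀ z ∈ ball (0 : ℂ) 1, HasSum (fun n => a n * z ^ n) (f z))
    (hb : ∀ z ∈ ball (0 : ℂ) 1, HasSum (fun n => b n * z ^ n) (f z)) : a = b := by
  have key : ∀ c : ℕ → ℂ, (∀ z ∈ ball (0 : ℂ) 1, HasSum (fun n => c n * z ^ n) (f z)) →
      HasFPowerSeriesAt f (FormalMultilinearSeries.ofScalars ℂ c) 0 := by
    intro c hc
    rw [hasFPowerSeriesAt_iff]
    filter_upwards [ball_mem_nhds (0 : ℂ) one_pos] with z hz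
    simpa [FormalMultilinearSeries.coeff_ofScalars, mul_comm] using hc z hz
  have h := (key a ha).eq_formalMultilinearSeries (key b hb)
  ext n
  simpa [FormalMultilinearSeries.coeff_ofScalars] using congrArg (fun p => p.coeff n) h

theorem H2.hasSum_eval (f : H2) {z : ℂ} (hz : z ∈ ball (0 : ℂ) 1) :
    HasSum (fun n => f n * z ^ n) (f.eval z) := by
  simpa [H2.taylor] using f.hasSum_taylor (mem_ball_zero_iff.1 hz)

/-- Elements of `H²` are stored as coefficient sequences. Uniqueness of Taylor coefficients turns
pointwise identities in the disc, such as `ω = gη + θh` or `g = ϑF`, into identities between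
multiplication operators. -/
theorem H2.ext_eval {f₁ f₂ : H2} (h : ∀ z ∈ ball (0 : ℂ) 1, f₁.eval z = f₂.eval z) : f₁ = f₂ :=
  lp.ext <| coeff_eq_of_hasSum_ball (f := f₁.eval) (fun _ hz => f₁.hasSum_eval hz)
    fun z hz => h z hz ▸ f₂.hasSum_eval hz

theorem H2.eval_add (f₁ f₂ : H2) {z : ℂ} (hz : z ∈ ball (0 : ℂ) 1) :
    (f₁ + f₂).eval z = f₁.eval z + f₂.eval z := by
  refine (H2.hasSum_eval _ hz).unique ?_
  simpa [add_mul] using (f₁.hasSum_eval hz).add (f₂.hasSum_eval hz)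

theorem HInf.mulOp_eq_add {ω g η θ h : HInf}
    (hid : ∀ z ∈ ball (0 : ℂ) 1, ω z = g z * η z + θ z * h z) (f : H2) :
    ω.mulOp f = g.mulOp (η.mulOp f) + θ.mulOp (h.mulOp f) := by
  refine H2.ext_eval fun z hz => ?_
  rw [H2.eval_add _ _ hz]
  simp only [HInf.eval_mulOp _ _ hz, hid z hz]
  ring

theorem HInf.mulOp_eq_of_eq_mul {g ϑ F : HInf} (h : ∀ z ∈ ball (0 : ℂ) 1, g z = ϑ z * F z)
    (f : H2) : g.mulOp f = ϑ.mulOp (F.mulOp f) := by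
  refine H2.ext_eval fun z hz => ?_
  simp only [HInf.eval_mulOp _ _ hz, h z hz, mul_assoc]

theorem HInf.mulOp_mul (g h : HInf) (f : H2) : (g * h).mulOp f = g.mulOp (h.mulOp f) :=
  HInf.mulOp_eq_of_eq_mul (fun _ _ => rfl) f

/-- The constant function `1` in `H²`. -/
def H2.one : H2 := lp.single 2 0 1

theorem H2.taylor_one : H2.one.taylor = 1 := by
  ext n
  rw [H2.taylor, PowerSeries.coeff_mk, PowerSeries.coeff_one, H2.one, lp.single_apply]
  simp [Pi.single_apply]

theorem H2.norm_one : ‖H2.one‖ = 1 := by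
  rw [H2.one, lp.norm_single (by norm_num)]; simp

theorem H2.eval_one {z : ℂ} (hz : z ∈ ball (0 : ℂ) 1) : H2.one.eval z = 1 := by
  refine (H2.hasSum_taylor _ (mem_ball_zero_iff.1 hz)).unique ?_
  rw [H2.taylor_one]
  convert hasSum_ite_eq (0 : ℕ) (1 : ℂ) using 2 with n
  rw [PowerSeries.coeff_one]
  split_ifs with h <;> simp [h]

theorem HInf.taylor_var : HInf.var.taylor = PowerSeries.X := by
  have : (fun n => PowerSeries.coeff n HInf.var.taylor) =
      fun n => PowerSeries.coeff n (PowerSeries.X : PowerSeries ℂ) := by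
    refine coeff_eq_of_hasSum_ball (f := HInf.var)
      (fun z hz => HInf.var.hasSum_taylor (mem_ball_zero_iff.1 hz)) fun z _ => ?_
    have h := hasSum_ite_eq (1 : ℕ) z
    change HasSum _ z
    convert h using 2 with n
    rw [PowerSeries.coeff_X]
    split_ifs with h <;> simp [h]
  ext n
  exact congrFun this n

theorem shift_taylor (f : H2) : (shift f).taylor = PowerSeries.X * f.taylor := by
  rw [shift, HInf.taylor_mulOp, HInf.taylor_var]

theorem shift_pow_taylor (n : ℕ) (f : H2) :
    ((shift ^ n) f).taylor = PowerSeries.X ^ n * f.taylor := by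
  induction n with
  | zero => simp
  | succ n ih =>
    rw [pow_succ', mul_apply_eq_comp, shift_taylor, ih, pow_succ', mul_assoc]

theorem H2.coeff_taylor (f : H2) (n : ℕ) : PowerSeries.coeff n f.taylor = f n := by
  simp [H2.taylor]

@[simp] theorem shift_apply_zero (f : H2) : shift f 0 = 0 := by
  rw [← H2.coeff_taylor, shift_taylor, PowerSeries.coeff_zero_X_mul]

@[simp] theorem shift_apply_succ (f : H2) (n : ℕ) : shift f (n + 1) = f n := by
  rw [← H2.coeff_taylor, shift_taylor, PowerSeries.coeff_succ_X_mul, H2.coeff_taylor]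

theorem shift_mulOp (g : HInf) (f : H2) : shift (g.mulOp f) = g.mulOp (shift f) :=
  HInf.mulOp_comm _ _ _

theorem inner_shift_shift (f₁ f₂ : H2) : inner ℂ (shift f₁) (shift f₂) = inner ℂ f₁ f₂ := by
  have h := (hasSum_nat_add_iff' 1).2 (lp.hasSum_inner (𝕜 := ℂ) (shift f₁) (shift f₂))
  simp only [shift_apply_succ, Finset.range_one, Finset.sum_singleton, shift_apply_zero,
    inner_zero_left, sub_zero] at h
  exact h.unique (lp.hasSum_inner (𝕜 := ℂ) f₁ f₂)

theorem norm_shift (f : H2) : ‖shift f‖ = ‖f‖ := by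
  rw [norm_eq_sqrt_re_inner (𝕜 := ℂ), inner_shift_shift, ← norm_eq_sqrt_re_inner]

theorem norm_shift_pow (n : ℕ) (f : H2) : ‖(shift ^ n) f‖ = ‖f‖ := by
  induction n with
  | zero => simp
  | succ n ih => rw [pow_succ', mul_apply_eq_comp, norm_shift, ih]

theorem inner_shift_pow_shift_pow (n : ℕ) (f₁ f₂ : H2) :
    inner ℂ ((shift ^ n) f₁) ((shift ^ n) f₂) = inner ℂ f₁ f₂ := by
  induction n with
  | zero => simp
  | succ n ih => simp only [pow_succ', mul_apply_eq_comp, inner_shift_shift, ih]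

/-- Every `f ∈ H²` is a constant plus a multiple of `z`. -/
theorem H2.exists_eq_smul_one_add_shift (f : H2) : ∃ f' : H2, f = f 0 • H2.one + shift f' := by
  have hmem : Memℓp (E := fun _ : ℕ => ℂ) (fun n => f (n + 1)) 2 := by
    refine memℓp_gen ?_
    have := (summable_nat_add_iff 1).2 f.norm_sq.summable
    simpa using this
  refine ⟨⟨_, hmem⟩, lp.ext (funext fun n => ?_)⟩
  have h1 : ∀ n, H2.one n = if n = 0 then 1 else 0 := fun n => by
    rw [← H2.coeff_taylor, H2.taylor_one, PowerSeries.coeff_one]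
  cases n with
  | zero =>
    simp only [lp.coeFn_add, lp.coeFn_smul, Pi.add_apply, Pi.smul_apply, h1, shift_apply_zero]
    simp
  | succ n =>
    simp only [lp.coeFn_add, lp.coeFn_smul, Pi.add_apply, Pi.smul_apply, h1, shift_apply_succ]
    simp

theorem HInf.norm_mulOp_le (g : HInf) {C : ℝ} (hC : ∀ z ∈ ball (0 : ℂ) 1, ‖g z‖ ≤ C) (f : H2) :
    ‖g.mulOp f‖ ≤ C * ‖f‖ := by
  have h0 : 0 ≤ C := (norm_nonneg _).trans (hC 0 (by simp))
  refine lp.norm_le_of_forall_sum_le (by norm_num) (by positivity) fun s => ?_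
  simpa [mul_pow, HInf.mulOp_apply] using g.sum_coeff_sq_le hC f s

theorem HInf.IsInner.eq_zero_of_mulOp_eq_zero {θ : HInf} (hθ : θ.IsInner) {f : H2}
    (h : θ.mulOp f = 0) : f = 0 := by
  simpa [h] using hθ.norm_le f

/-! ### The functional calculus of the shift -/

/-- The dilated function `z ↦ g (r z)`. -/
def HInf.dilate (g : HInf) {r : ℝ} (hr : r ∈ Set.Ioo (0 : ℝ) 1) : HInf where
  toFun z := g (r * z)
  differentiableOn := g.differentiableOn.comp (by fun_prop) fun z hz => by
    rw [mem_ball_zero_iff] at hz ⊢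
    rw [norm_mul, Complex.norm_real, Real.norm_eq_abs, abs_of_pos hr.1]
    nlinarith [hr.1, hr.2, norm_nonneg z]
  bounded := by
    obtain ⟨C, hC⟩ := g.bounded
    refine ⟨C, fun z hz => hC _ ?_⟩
    rw [mem_ball_zero_iff] at hz ⊢
    rw [norm_mul, Complex.norm_real, Real.norm_eq_abs, abs_of_pos hr.1]
    nlinarith [hr.1, hr.2, norm_nonneg z]

theorem HInf.coeff_taylor_dilate (g : HInf) {r : ℝ} (hr : r ∈ Set.Ioo (0 : ℝ) 1) (n : ℕ) :
    PowerSeries.coeff n (g.dilate hr).taylor = PowerSeries.coeff n g.taylor * (r : ℂ) ^ n := by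
  refine congrFun (coeff_eq_of_hasSum_ball (f := g.dilate hr)
    (a := fun n => PowerSeries.coeff n (g.dilate hr).taylor)
    (b := fun n => PowerSeries.coeff n g.taylor * (r : ℂ) ^ n)
    (fun z hz => (g.dilate hr).hasSum_taylor (mem_ball_zero_iff.1 hz)) fun z hz => ?_) n
  have : ‖(r : ℂ) * z‖ < 1 := by
    rw [norm_mul, Complex.norm_real, Real.norm_eq_abs, abs_of_pos hr.1]
    nlinarith [hr.1, hr.2, norm_nonneg z, mem_ball_zero_iff.1 hz]
  simpa [mul_pow, mul_assoc, HInf.dilate] using g.hasSum_taylor this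

theorem HInf.norm_dilate_mulOp_le (g : HInf) {C : ℝ} (hC : ∀ z ∈ ball (0 : ℂ) 1, ‖g z‖ ≤ C)
    {r : ℝ} (hr : r ∈ Set.Ioo (0 : ℝ) 1) (f : H2) : ‖(g.dilate hr).mulOp f‖ ≤ C * ‖f‖ := by
  refine HInf.norm_mulOp_le (g.dilate hr) (fun z hz => hC (r * z) ?_) f
  rw [mem_ball_zero_iff] at hz ⊢
  rw [norm_mul, Complex.norm_real, Real.norm_eq_abs, abs_of_pos hr.1]
  nlinarith [hr.1, hr.2, norm_nonneg z]

theorem norm_shift_pow_le (n : ℕ) : ‖shift ^ n‖ ≤ 1 :=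
  ContinuousLinearMap.opNorm_le_bound _ zero_le_one fun f => by rw [norm_shift_pow, one_mul]

theorem HInf.summable_calculus_shift (g : HInf) {r : ℝ} (hr : r ∈ Set.Ioo (0 : ℝ) 1) :
    Summable fun n => (PowerSeries.coeff n g.taylor * (r : ℂ) ^ n) • shift ^ n := by
  have hr' : ‖(r : ℂ)‖ < 1 := by simpa [abs_of_pos hr.1] using hr.2
  refine Summable.of_norm_bounded (g.summable_norm_taylor hr') fun n => ?_
  rw [norm_smul]
  exact mul_le_of_le_one_right (norm_nonneg _) (norm_shift_pow_le n)

/-- Recognizing `g_r(S)` as multiplication by a dilation of `g` bounds its norm by `sup |g|`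
uniformly in `r`. Estimating the series term by term would not give a uniform bound. -/
theorem HInf.tsum_calculus_shift (g : HInf) {r : ℝ} (hr : r ∈ Set.Ioo (0 : ℝ) 1) (f : H2) :
    (∑' n, (PowerSeries.coeff n g.taylor * (r : ℂ) ^ n) • shift ^ n) f =
      (g.dilate hr).mulOp f := by
  have hs : HasSum (fun n => (PowerSeries.coeff n g.taylor * (r : ℂ) ^ n) • (shift ^ n) f)
      ((∑' n, (PowerSeries.coeff n g.taylor * (r : ℂ) ^ n) • shift ^ n) f) := by
    simpa using ((ContinuousLinearMap.apply ℂ H2 f).hasSum (g.summable_calculus_shift hr).hasSum)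
  refine lp.ext (funext fun m => ?_)
  have h1 := (lp.evalCLM ℂ (fun _ : ℕ => ℂ) 2 m).hasSum hs
  refine h1.unique ?_
  have h2 : ∀ n, (lp.evalCLM ℂ (fun _ : ℕ => ℂ) 2 m)
      ((PowerSeries.coeff n g.taylor * (r : ℂ) ^ n) • (shift ^ n) f) =
      if n ≤ m then PowerSeries.coeff n (g.dilate hr).taylor * f (m - n) else 0 := by
    intro n
    rw [map_smul]
    change _ • ((shift ^ n) f) m = _
    rw [← H2.coeff_taylor, shift_pow_taylor, PowerSeries.coeff_X_pow_mul', H2.coeff_taylor,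
      HInf.coeff_taylor_dilate]
    split_ifs <;> simp
  simp only [h2]
  have h3 : (g.dilate hr).mulOp f m = ∑ n ∈ Finset.range (m + 1),
      if n ≤ m then PowerSeries.coeff n (g.dilate hr).taylor * f (m - n) else 0 := by
    rw [HInf.mulOp_apply, PowerSeries.coeff_mul,
      Finset.Nat.sum_antidiagonal_eq_sum_range_succ
        (fun i j => PowerSeries.coeff i (g.dilate hr).taylor * PowerSeries.coeff j f.taylor)]
    refine Finset.sum_congr rfl fun n hn => ?_
    rw [if_pos (Finset.mem_range_succ_iff.1 hn), H2.coeff_taylor]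
  rw [h3]
  refine hasSum_sum_of_ne_finset_zero fun n hn => if_neg ?_
  simpa [Nat.lt_succ_iff] using hn

theorem HInf.mulOp_sub_apply_one (g₁ g₂ : HInf) (n : ℕ) :
    (g₁.mulOp H2.one - g₂.mulOp H2.one) n =
      PowerSeries.coeff n g₁.taylor - PowerSeries.coeff n g₂.taylor := by
  rw [lp.coeFn_sub, Pi.sub_apply, HInf.mulOp_apply, HInf.mulOp_apply, H2.taylor_one, mul_one,
    mul_one]

/-- Dominated convergence with majorant `|cₙ|²`, summable because `g = g · 1` lies in `H²`. The sum
is the squared norm of `g_r - g` in `H²`. -/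
theorem HInf.tendsto_dilate_one (g : HInf) :
    Tendsto (fun r : ℝ => ∑' n, ‖PowerSeries.coeff n g.taylor * (r : ℂ) ^ n -
      PowerSeries.coeff n g.taylor‖ ^ 2) (𝓝[<] 1) (𝓝 0) := by
  have hsum : Summable fun n => ‖PowerSeries.coeff n g.taylor‖ ^ 2 := by
    have := (g.mulOp H2.one).norm_sq.summable
    simpa [HInf.mulOp_apply, H2.taylor_one] using this
  have h := tendsto_tsum_of_dominated_convergence (𝓕 := 𝓝[<] (1 : ℝ))
    (f := fun (r : ℝ) n => ‖PowerSeries.coeff n g.taylor * (r : ℂ) ^ n -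
      PowerSeries.coeff n g.taylor‖ ^ 2) (g := fun _ => (0 : ℝ)) hsum ?_ ?_
  · simpa using h
  · intro n
    have hc : Continuous fun r : ℝ => ‖PowerSeries.coeff n g.taylor * (r : ℂ) ^ n -
      PowerSeries.coeff n g.taylor‖ ^ 2 := by fun_prop
    have := hc.tendsto 1
    simp only [Complex.ofReal_one, one_pow, mul_one, sub_self, norm_zero, ne_eq,
      OfNat.ofNat_ne_zero, not_false_eq_true, zero_pow] at this
    exact this.mono_left nhdsWithin_le_nhds
  · filter_upwards [Ioo_mem_nhdsLT (show (0 : ℝ) < 1 by norm_num)] with r hr n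
    rw [norm_pow, norm_norm]
    have h1 : PowerSeries.coeff n g.taylor * (r : ℂ) ^ n - PowerSeries.coeff n g.taylor =
        PowerSeries.coeff n g.taylor * ((r ^ n - 1 : ℝ) : ℂ) := by push_cast; ring
    rw [h1, norm_mul, Complex.norm_real, Real.norm_eq_abs]
    have h2 : |r ^ n - 1| ≤ 1 := by
      have := pow_le_one₀ hr.1.le hr.2.le (n := n)
      have := pow_nonneg hr.1.le n
      rw [abs_le]; constructor <;> linarith
    gcongr
    exact mul_le_of_le_one_right (norm_nonneg _) h2

theorem H2.single_eq_smul (n : ℕ) (c : ℂ) : lp.single 2 n c = c • (shift ^ n) H2.one := by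
  refine lp.ext (funext fun m => ?_)
  rw [lp.coeFn_smul, Pi.smul_apply, ← H2.coeff_taylor ((shift ^ n) H2.one), shift_pow_taylor,
    H2.taylor_one, mul_one, PowerSeries.coeff_X_pow, lp.single_apply, Pi.single_apply]
  split_ifs <;> simp

theorem shift_pow_one (n : ℕ) : (shift ^ n) H2.one = lp.single 2 n 1 := by
  rw [H2.single_eq_smul, one_smul]

/-- `g_r(S)` converges to `g(S)` strongly. -/
theorem HInf.tendsto_calculus_shift (g : HInf) (f : H2) :
    Tendsto (fun r : ℝ =>
      (∑' n, (PowerSeries.coeff n g.taylor * (r : ℂ) ^ n) • shift ^ n) f)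
      (𝓝[<] 1) (𝓝 (g.mulOp f)) := by
  obtain ⟨C, hC⟩ := g.bounded
  have h0 : 0 ≤ C := (norm_nonneg _).trans (hC 0 (by simp))
  set A : ℝ → H2 →L[ℂ] H2 :=
    fun r => ∑' n, (PowerSeries.coeff n g.taylor * (r : ℂ) ^ n) • shift ^ n with hA
  -- By the uniform bound on `g_r(S)`, convergence on polynomials is enough. Since `g_r(S)` commutes
  -- with `S`, convergence on monomials reduces to convergence at the constant `1`.
  have hone : Tendsto (fun r => A r H2.one) (𝓝[<] 1) (𝓝 (g.mulOp H2.one)) := by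
    rw [tendsto_iff_norm_sub_tendsto_zero]
    have h := g.tendsto_dilate_one.sqrt
    rw [Real.sqrt_zero] at h
    refine h.congr' ?_
    filter_upwards [Ioo_mem_nhdsLT (show (0 : ℝ) < 1 by norm_num)] with r hr
    rw [hA]
    simp only [g.tsum_calculus_shift hr]
    rw [Real.sqrt_eq_iff_mul_self_eq (tsum_nonneg fun _ => by positivity) (norm_nonneg _), ← sq,
      ← (H2.norm_sq _).tsum_eq]
    simp only [HInf.mulOp_sub_apply_one, HInf.coeff_taylor_dilate]
  have hshift : ∀ f : H2, Tendsto (fun r => A r f) (𝓝[<] 1) (𝓝 (g.mulOp f)) →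
      Tendsto (fun r => A r (shift f)) (𝓝[<] 1) (𝓝 (g.mulOp (shift f))) := by
    intro f hf
    rw [← shift_mulOp]
    refine ((shift.continuous.tendsto _).comp hf).congr' ?_
    filter_upwards [Ioo_mem_nhdsLT (show (0 : ℝ) < 1 by norm_num)] with r hr
    simp only [Function.comp_apply, hA, g.tsum_calculus_shift hr, shift_mulOp]
  have hfin : ∀ s : Finset ℕ, Tendsto (fun r => A r (∑ n ∈ s, lp.single 2 n (f n))) (𝓝[<] 1)
      (𝓝 (g.mulOp (∑ n ∈ s, lp.single 2 n (f n)))) := by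
    intro s
    simp only [map_sum, H2.single_eq_smul, map_smul]
    refine tendsto_finsetSum s fun n _ => Tendsto.const_smul ?_ _
    clear * - hone hshift
    induction n with
    | zero => simpa using hone
    | succ n ih =>
      simp only [pow_succ', mul_apply_eq_comp]
      exact hshift _ ih
  have happ := lp.hasSum_single (E := fun _ : ℕ => ℂ) (p := 2) (by norm_num) f
  rw [Metric.tendsto_nhds]
  intro ε hε
  -- The terms `g_r(S)(f - p)` and `g(f - p)` will each be smaller than `ε / 4`. Using `C + 1` keeps
  -- the denominator positive when `C = 0`.
  obtain ⟨s, hs⟩ := ((Metric.tendsto_nhds.1 happ) (ε / (4 * (C + 1))) (by positivity)).exists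
  rw [dist_eq_norm, norm_sub_rev] at hs
  set p : H2 := ∑ n ∈ s, lp.single 2 n (f n) with hp
  filter_upwards [Ioo_mem_nhdsLT (show (0 : ℝ) < 1 by norm_num),
    (Metric.tendsto_nhds.1 (hfin s)) (ε / 2) (by positivity)] with r hr hrp
  rw [dist_eq_norm] at hrp ⊢
  have h1 : ‖A r (f - p)‖ ≤ C * ‖f - p‖ := by
    simp only [hA, g.tsum_calculus_shift hr]
    exact g.norm_dilate_mulOp_le hC hr _
  have h2 := g.norm_mulOp_le hC (f - p)
  have h3 : A r f - g.mulOp f = A r (f - p) + (A r p - g.mulOp p) - g.mulOp (f - p) := by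
    simp only [map_sub]; abel
  rw [lt_div_iff₀ (by positivity)] at hs
  calc ‖A r f - g.mulOp f‖ ≤ ‖A r (f - p)‖ + ‖A r p - g.mulOp p‖ + ‖g.mulOp (f - p)‖ := by
        rw [h3]
        exact (norm_sub_le _ _).trans (add_le_add_left (norm_add_le _ _) _)
    _ < ε := by nlinarith [norm_nonneg (f - p)]

theorem HInf.isHInfCalculus_shift (g : HInf) : IsHInfCalculus g shift g.mulOp :=
  ⟨fun _ hr => g.summable_calculus_shift hr, g.tendsto_calculus_shift⟩

/-! ### Invariant subspaces of the shift -/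

/-- Every element of `A` is divisible by all powers of `z` within `A`, so all of its Taylor
coefficients vanish. -/
theorem eq_zero_of_forall_exists_shift {A : Set H2} (hA : ∀ y ∈ A, ∃ y' ∈ A, y = shift y')
    {y : H2} (hy : y ∈ A) : y = 0 := by
  refine lp.ext (funext fun n => ?_)
  rw [lp.coeFn_zero, Pi.zero_apply]
  induction n generalizing y with
  | zero =>
    obtain ⟨y', -, rfl⟩ := hA y hy
    exact shift_apply_zero y'
  | succ n ih =>
    obtain ⟨y', hy', rfl⟩ := hA y hy
    rw [shift_apply_succ]
    exact ih hy'

theorem isClosed_map_shift {N : Submodule ℂ H2} (hN : IsClosed (N : Set H2)) :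
    IsClosed (N.map shift.toLinearMap : Set H2) := by
  have h : Isometry shift := AddMonoidHomClass.isometry_of_norm shift norm_shift
  rw [Submodule.map_coe]
  exact h.isClosedEmbedding.isClosedMap _ hN

theorem HInf.shift_mem_closure_range (φ : HInf) {y : H2} (hy : y ∈ φ.range.topologicalClosure) :
    shift y ∈ φ.range.topologicalClosure :=
  map_mem_closure shift.continuous hy fun f hf => HInf.mulOp_mem_range HInf.var φ f hf

/-- **Beurling's theorem** for the cyclic subspace generated by `φ ∈ H^∞`: the closure of `φ H²` has
an orthonormal basis on which `S` acts as a shift. -/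
theorem HInf.exists_hilbertBasis_closure_range (φ : HInf) (hφ : φ.mulOp H2.one ≠ 0) :
    ∃ b : HilbertBasis ℕ ℂ φ.range.topologicalClosure,
      (∀ n, (b (n + 1) : H2) = shift (b n)) ∧
      ∀ y ∈ φ.range.topologicalClosure, inner ℂ (b 0 : H2) (shift y) = 0 := by
  set N := φ.range.topologicalClosure with hN
  set x := φ.mulOp H2.one with hx
  have hNc : IsClosed (N : Set H2) := Submodule.isClosed_topologicalClosure _
  have hNS : ∀ y ∈ N, shift y ∈ N := fun y hy => φ.shift_mem_closure_range hy
  have hle : φ.range ≤ N := Submodule.le_topologicalClosure _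
  have hxN : x ∈ N := hle ⟨H2.one, rfl⟩
  set W := N.map shift.toLinearMap with hW
  have hWc : IsClosed (W : Set H2) := isClosed_map_shift hNc
  have hWN : W ≤ N := by
    rintro _ ⟨y, hy, rfl⟩
    exact hNS y hy
  have : CompleteSpace W := hWc.completeSpace_coe
  have : CompleteSpace N := hNc.completeSpace_coe
  -- Since `φf = f(0)φ + zφf'`, the closed subspace generated by `x` and `W = SN` is all of `N`.
  -- Thus `W` has codimension at most one in `N`.
  have hgen : ∀ K : Submodule ℂ H2, IsClosed (K : Set H2) → x ∈ K → W ≤ K → N ≤ K := by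
    intro K hK hxK hWK
    refine Submodule.topologicalClosure_minimal _ ?_ hK
    rintro _ ⟨f, rfl⟩
    obtain ⟨f', hf'⟩ := f.exists_eq_smul_one_add_shift
    have h : φ.mulOp f = f 0 • x + shift (φ.mulOp f') := by
      conv_lhs => rw [hf']
      rw [map_add, map_smul, shift_mulOp]
    change φ.mulOp f ∈ K
    rw [h]
    exact K.add_mem (K.smul_mem _ hxK) (hWK ⟨_, hle ⟨f', rfl⟩, rfl⟩)
  set e := x - W.starProjection x with he
  have heN : e ∈ N := N.sub_mem hxN (hWN (W.starProjection_apply_mem x))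
  have heW : e ∈ Wᗮ := W.sub_starProjection_mem_orthogonal x
  -- If `x` were in `W`, then `N = SN`, and every element of `N` would be infinitely divisible by
  -- `z`.
  have he0 : e ≠ 0 := by
    intro h0
    have hxW : x ∈ W := by
      rw [sub_eq_zero.1 h0]
      exact W.starProjection_apply_mem x
    refine hφ (eq_zero_of_forall_exists_shift (A := (N : Set H2)) (fun y hy => ?_) hxN)
    obtain ⟨y', hy', rfl⟩ := hgen W hWc hxW le_rfl hy
    exact ⟨y', hy', rfl⟩
  -- The part `y₀` of `y` orthogonal to `W` is also orthogonal to `e`, hence to `x`, hence to the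
  -- whole of `N`, which contains `y₀` itself. So `y₀ = 0` and `y` lies in `SN`.
  have hdiv : ∀ y ∈ N, inner ℂ e y = 0 → ∃ y' ∈ N, y = shift y' := by
    intro y hy hey
    set y₀ := y - W.starProjection y with hy₀
    have h1 : y₀ ∈ N := N.sub_mem hy (hWN (W.starProjection_apply_mem y))
    have h2 : y₀ ∈ Wᗮ := W.sub_starProjection_mem_orthogonal y
    have h3 : inner ℂ y₀ e = 0 := by
      rw [hy₀, inner_sub_left, inner_eq_zero_symm.1 hey, heW _ (W.starProjection_apply_mem y),
        sub_zero]
    have h4 : inner ℂ y₀ x = 0 := by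
      have : x = e + W.starProjection x := by rw [he]; abel
      rw [this, inner_add_right, h3, zero_add]
      exact inner_eq_zero_symm.1 (h2 _ (W.starProjection_apply_mem x))
    have h5 := hgen (ℂ ∙ y₀)ᗮ (Submodule.isClosed_orthogonal _)
      (Submodule.mem_orthogonal_singleton_iff_inner_right.2 h4)
      (fun w hw => Submodule.mem_orthogonal_singleton_iff_inner_right.2
        (inner_eq_zero_symm.1 (h2 w hw))) h1
    have h6 : y₀ = 0 := inner_self_eq_zero.1
      (Submodule.mem_orthogonal_singleton_iff_inner_right.1 h5)
    have h7 : y ∈ W := by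
      rw [sub_eq_zero.1 h6]
      exact W.starProjection_apply_mem y
    obtain ⟨y', hy', h⟩ := h7
    exact ⟨y', hy', h.symm⟩
  set e' : H2 := ((‖e‖⁻¹ : ℝ) : ℂ) • e with he'
  have hne : ‖e‖ ≠ 0 := norm_ne_zero_iff.2 he0
  have he'n : ‖e'‖ = 1 := by
    rw [he', norm_smul, Complex.norm_real, norm_inv, norm_norm, inv_mul_cancel₀ hne]
  have he'N : e' ∈ N := N.smul_mem _ heN
  have he'W : ∀ y ∈ N, inner ℂ e' (shift y) = 0 := by
    intro y hy
    have h : inner ℂ (shift y) e = 0 := heW _ ⟨y, hy, rfl⟩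
    rw [he', inner_smul_left, inner_eq_zero_symm.1 h, mul_zero]
  have hpow : ∀ n, ∀ y ∈ N, (shift ^ n) y ∈ N := by
    intro n
    induction n with
    | zero => intro y hy; simpa using hy
    | succ n ih =>
      intro y hy
      rw [pow_succ', mul_apply_eq_comp]
      exact hNS _ (ih y hy)
  let v : ℕ → N := fun n => ⟨(shift ^ n) e', hpow n _ he'N⟩
  have hlt : ∀ n m, n < m → inner ℂ (v n) (v m) = 0 := by
    intro n m hnm
    obtain ⟨k, rfl⟩ := Nat.exists_eq_add_of_lt hnm
    change inner ℂ ((shift ^ n) e') ((shift ^ (n + k + 1)) e') = 0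
    rw [add_assoc, pow_add, mul_apply_eq_comp, inner_shift_pow_shift_pow, pow_succ',
      mul_apply_eq_comp]
    exact he'W _ (hpow k _ he'N)
  have hv : Orthonormal ℂ v := by
    refine ⟨fun n => ?_, fun n m hnm => ?_⟩
    · change ‖(shift ^ n) e'‖ = 1
      rw [norm_shift_pow, he'n]
    · rcases lt_or_gt_of_ne hnm with h | h
      · exact hlt n m h
      · exact inner_eq_zero_symm.1 (hlt m n h)
  -- A vector `z` orthogonal to every `Sⁿe'` is `Sz'` with `z'` in `N`, and `z'` is again orthogonal
  -- to every `Sⁿe'` because `S` is isometric. Infinite divisibility forces `z = 0`.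
  have hsp : (Submodule.span ℂ (Set.range v))ᗮ = ⊥ := by
    rw [Submodule.eq_bot_iff]
    intro y hy
    have hyv : ∀ n, inner ℂ ((shift ^ n) e') (y : H2) = 0 := fun n =>
      hy (v n) (Submodule.subset_span ⟨n, rfl⟩)
    refine Subtype.ext (eq_zero_of_forall_exists_shift
      (A := {y | y ∈ N ∧ ∀ n, inner ℂ ((shift ^ n) e') y = 0}) ?_ ⟨y.2, hyv⟩)
    rintro z ⟨hz, hzv⟩
    have hze : inner ℂ e z = 0 := by
      have := hzv 0
      rw [pow_zero, one_apply_eq_self, he', inner_smul_left] at this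
      refine (mul_eq_zero.1 this).resolve_left ?_
      simpa using hne
    obtain ⟨z', hz', rfl⟩ := hdiv z hz hze
    refine ⟨z', ⟨hz', fun n => ?_⟩, rfl⟩
    have := hzv (n + 1)
    rwa [pow_succ', mul_apply_eq_comp, inner_shift_shift] at this
  refine ⟨HilbertBasis.mkOfOrthogonalEqBot hv hsp, fun n => ?_, fun y hy => ?_⟩
  · rw [HilbertBasis.coe_mkOfOrthogonalEqBot]
    change (shift ^ (n + 1)) e' = shift ((shift ^ n) e')
    rw [pow_succ', mul_apply_eq_comp]
  · rw [HilbertBasis.coe_mkOfOrthogonalEqBot]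
    change inner ℂ ((shift ^ 0) e') _ = 0
    rw [pow_zero, one_apply_eq_self]
    exact he'W y hy

/-- The restriction of the shift to the closure of `φ H²` is unitarily equivalent to the shift. -/
theorem HInf.exists_equiv_closure_range (φ : HInf) (hφ : φ.mulOp H2.one ≠ 0) :
    ∃ Z : φ.range.topologicalClosure ≃L[ℂ] H2, ∀ (y : H2) (hy : y ∈ φ.range.topologicalClosure),
      Z ⟨shift y, φ.shift_mem_closure_range hy⟩ = shift (Z ⟨y, hy⟩) := by
  obtain ⟨b, hb, hb0⟩ := φ.exists_hilbertBasis_closure_range hφ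
  refine ⟨b.repr.toContinuousLinearEquiv, fun y hy => lp.ext (funext fun n => ?_)⟩
  change b.repr _ n = shift (b.repr _) n
  cases n with
  | zero =>
    rw [shift_apply_zero, b.repr_apply_apply]
    exact hb0 y hy
  | succ n =>
    rw [shift_apply_succ, b.repr_apply_apply, b.repr_apply_apply, Submodule.coe_inner,
      Submodule.coe_inner, hb, inner_shift_shift]

/-! ### Operators bounded below on a subspace -/

section BoundedBelow

variable {E F : Type*} [NormedAddCommGroup E] [NormedSpace ℂ E] [NormedAddCommGroup F]
  [NormedSpace ℂ F]

theorem norm_le_of_mem_topologicalClosure {D : Submodule ℂ E} (Y : E →L[ℂ] F) {C : ℝ}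
    (hC : ∀ x ∈ D, ‖x‖ ≤ C * ‖Y x‖) : ∀ x ∈ D.topologicalClosure, ‖x‖ ≤ C * ‖Y x‖ := by
  have hcl : IsClosed {x : E | ‖x‖ ≤ C * ‖Y x‖} := isClosed_le (by fun_prop) (by fun_prop)
  exact fun x hx => closure_minimal hC hcl hx

/-- The lower bound passes to the closure of `D` by continuity. An operator bounded below on a
complete space has closed range, so the image of the closure is already closed. -/
theorem map_topologicalClosure_eq [CompleteSpace E] {D : Submodule ℂ E} (Y : E →L[ℂ] F) {C : ℝ}
    (hC : ∀ x ∈ D, ‖x‖ ≤ C * ‖Y x‖) :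
    D.topologicalClosure.map Y.toLinearMap = (D.map Y.toLinearMap).topologicalClosure := by
  have hC' := norm_le_of_mem_topologicalClosure Y hC
  refine le_antisymm ?_ ?_
  · rintro _ ⟨x, hx, rfl⟩
    exact map_mem_closure Y.continuous hx fun x hx => ⟨x, hx, rfl⟩
  · refine Submodule.topologicalClosure_minimal _
      (Submodule.map_mono (Submodule.le_topologicalClosure _)) ?_
    have : CompleteSpace D.topologicalClosure :=
      (Submodule.isClosed_topologicalClosure D).completeSpace_coe
    have hanti : AntilipschitzWith C.toNNReal (Y ∘L D.topologicalClosure.subtypeL) :=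
      AddMonoidHomClass.antilipschitz_of_bound _ fun x =>
        (hC' x x.2).trans (mul_le_mul_of_nonneg_right (Real.le_coe_toNNReal C) (norm_nonneg _))
    convert hanti.isClosed_range (Y ∘L D.topologicalClosure.subtypeL).uniformContinuous using 1
    ext y
    simp
    rfl

theorem exists_equiv_of_norm_le [CompleteSpace E] [CompleteSpace F] {M : Submodule ℂ E}
    {N : Submodule ℂ F} (hM : IsClosed (M : Set E)) (hN : IsClosed (N : Set F)) (Y : E →L[ℂ] F)
    (hMN : M.map Y.toLinearMap = N) {C : ℝ} (hC : ∀ x ∈ M, ‖x‖ ≤ C * ‖Y x‖) :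
    ∃ Z : M ≃L[ℂ] N, ∀ x : M, (Z x : F) = Y x := by
  have : CompleteSpace M := hM.completeSpace_coe
  have : CompleteSpace N := hN.completeSpace_coe
  have hmem : ∀ x : M, (Y ∘L M.subtypeL) x ∈ N := fun x => hMN ▸ ⟨x, x.2, rfl⟩
  refine ⟨ContinuousLinearEquiv.ofBijective ((Y ∘L M.subtypeL).codRestrict N hmem) ?_ ?_,
    fun x => rfl⟩
  · refine LinearMap.ker_eq_bot'.2 fun x hx => ?_
    have h0 : Y x = 0 := congrArg Subtype.val hx
    have := hC x x.2
    rw [h0, norm_zero, mul_zero] at this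
    exact Subtype.ext (norm_le_zero_iff.1 this)
  · refine LinearMap.range_eq_top.2 fun y => ?_
    obtain ⟨x, hx, hxy⟩ : (y : F) ∈ M.map Y.toLinearMap := hMN ▸ y.2
    exact ⟨⟨x, hx⟩, Subtype.ext hxy⟩

end BoundedBelow

/-! ### The model operator -/

theorem HInf.mulOp_apply_mem_range (θ : HInf) (f : H2) : θ.mulOp f ∈ θ.range := ⟨f, rfl⟩

theorem HInf.shift_mem_range {θ : HInf} {f : H2} (hf : f ∈ θ.range) : shift f ∈ θ.range :=
  HInf.var.mulOp_mem_range θ f hf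

theorem HInf.IsInner.projRange_of_mem {θ : HInf} (hθ : θ.IsInner) {f : H2} (hf : f ∈ θ.range) :
    (hθ.projRange f : H2) = f := by
  have := hθ.hasOrthogonalProjection
  exact congrArg Subtype.val (Submodule.orthogonalProjectionOnto_mem_subspace_eq_self ⟨f, hf⟩)

theorem HInf.projModel_of_mem_range {θ : HInf} {f : H2} (hf : f ∈ θ.range) :
    θ.projModel f = 0 :=
  Submodule.orthogonalProjectionOnto_eq_zero_iff.2 (Submodule.le_orthogonal_orthogonal _ hf)

theorem HInf.projModel_coe {θ : HInf} (k : θ.model) : θ.projModel k = k :=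
  Submodule.orthogonalProjectionOnto_mem_subspace_eq_self k

theorem HInf.IsInner.projRange_add_projModel {θ : HInf} (hθ : θ.IsInner) (f : H2) :
    (hθ.projRange f : H2) + θ.projModel f = f := by
  have := hθ.hasOrthogonalProjection
  exact θ.range.starProjection_add_starProjection_orthogonal f

/-- Multiplication by `g` keeps the `θH²` component of `f` in `θH²`, where the projection onto `K_θ`
vanishes. This makes compression to `K_θ` multiplicative. -/
theorem HInf.IsInner.projModel_mulOp_projModel {θ : HInf} (hθ : θ.IsInner) (g : HInf) (f : H2) :
    θ.projModel (g.mulOp (θ.projModel f)) = θ.projModel (g.mulOp f) := by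
  conv_rhs => rw [← hθ.projRange_add_projModel f]
  rw [map_add, map_add, HInf.projModel_of_mem_range (g.mulOp_mem_range θ _ (Subtype.prop _)),
    zero_add]

theorem HInf.IsInner.modelOp_projModel {θ : HInf} (hθ : θ.IsInner) (f : H2) :
    θ.modelOp (θ.projModel f) = θ.projModel (shift f) :=
  hθ.projModel_mulOp_projModel HInf.var f

theorem HInf.IsInner.modelOp_pow_projModel {θ : HInf} (hθ : θ.IsInner) (n : ℕ) (f : H2) :
    (θ.modelOp ^ n) (θ.projModel f) = θ.projModel ((shift ^ n) f) := by
  induction n with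
  | zero => simp
  | succ n ih =>
    rw [pow_succ', mul_apply_eq_comp, ih, hθ.modelOp_projModel, pow_succ', mul_apply_eq_comp]

/-- `g(T_θ) = P_{K_θ} g(S)|_{K_θ}`. -/
theorem HInf.IsInner.eq_of_isHInfCalculus {θ : HInf} (hθ : θ.IsInner) {g : HInf}
    {A : θ.model →L[ℂ] θ.model} (hA : IsHInfCalculus g θ.modelOp A) (f : H2) :
    A (θ.projModel f) = θ.projModel (g.mulOp f) := by
  refine tendsto_nhds_unique (hA.2 _)
    (((θ.projModel.continuous.tendsto _).comp (g.tendsto_calculus_shift f)).congr' ?_)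
  filter_upwards [Ioo_mem_nhdsLT (show (0 : ℝ) < 1 by norm_num)] with r hr
  have h1 := (ContinuousLinearMap.apply ℂ θ.model (θ.projModel f)).hasSum (hA.1 r hr).hasSum
  have h2 := θ.projModel.hasSum
    ((ContinuousLinearMap.apply ℂ H2 f).hasSum (g.summable_calculus_shift hr).hasSum)
  have h3 : (fun n => θ.projModel (ContinuousLinearMap.apply ℂ H2 f
      ((PowerSeries.coeff n g.taylor * (r : ℂ) ^ n) • shift ^ n))) =
      fun n => ContinuousLinearMap.apply ℂ θ.model (θ.projModel f)
        ((PowerSeries.coeff n g.taylor * (r : ℂ) ^ n) • θ.modelOp ^ n) := by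
    ext1 n
    change θ.projModel ((_ : ℂ) • (shift ^ n) f) = (_ : ℂ) • (θ.modelOp ^ n) (θ.projModel f)
    rw [map_smul, hθ.modelOp_pow_projModel]
  rw [h3] at h2
  exact h2.unique h1

/-! ### The operators `X`, `Y` and `T` -/

section Operators

variable {H₀ : Type*} [NormedAddCommGroup H₀] [InnerProductSpace ℂ H₀] {θ : HInf}
  (hθ : θ.IsInner) (g : HInf) (T₀ : H₀ →L[ℂ] H₀) (X₀ : θ.model →L[ℂ] H₀) (Y₀ : H₀ →L[ℂ] θ.model)

/-- Because `g(S)` leaves `θH²` invariant, the two entries in the first row of `X` combine into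
`P_{θH²} g(S)`. In the same way the first row of `T` is `P_{θH²} S Y`. -/
theorem opX_fst (f : H2) : (opX g hθ X₀ f).fst = hθ.projRange (g.mulOp f) := by
  refine Subtype.ext ?_
  change g.mulOp (hθ.projRange f) + (hθ.projRange (g.mulOp (θ.projModel f)) : H2) = _
  conv_rhs => rw [← hθ.projRange_add_projModel f]
  rw [map_add, map_add, Submodule.coe_add,
    hθ.projRange_of_mem (g.mulOp_mem_range θ _ (Subtype.prop _))]

theorem opX_snd (f : H2) : (opX g hθ X₀ f).snd = X₀ (θ.projModel f) := rfl

theorem opY_apply (w : DirectSumSpace θ H₀) : opY θ Y₀ w = (w.fst : H2) + Y₀ w.snd := rfl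

theorem opT_fst (w : DirectSumSpace θ H₀) :
    (opT hθ T₀ Y₀ w).fst = hθ.projRange (shift (opY θ Y₀ w)) := by
  refine Subtype.ext ?_
  change shift w.fst + (hθ.projRange (shift (Y₀ w.snd)) : H2) = _
  rw [opY_apply, map_add, map_add, Submodule.coe_add,
    hθ.projRange_of_mem (HInf.shift_mem_range (Subtype.prop _))]

theorem opT_snd (w : DirectSumSpace θ H₀) : (opT hθ T₀ Y₀ w).snd = T₀ w.snd := rfl

variable {g T₀ X₀ Y₀}

theorem opY_opX (hYX : IsHInfCalculus g θ.modelOp (Y₀ ∘L X₀)) (f : H2) :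
    opY θ Y₀ (opX g hθ X₀ f) = g.mulOp f := by
  rw [opY_apply, opX_fst, opX_snd]
  have := hθ.eq_of_isHInfCalculus hYX f
  rw [ContinuousLinearMap.comp_apply] at this
  rw [this, hθ.projRange_add_projModel]

theorem opX_shift (hYX : IsHInfCalculus g θ.modelOp (Y₀ ∘L X₀))
    (hX : X₀ ∘L θ.modelOp = T₀ ∘L X₀) (f : H2) :
    opX g hθ X₀ (shift f) = opT hθ T₀ Y₀ (opX g hθ X₀ f) := by
  refine WithLp.ofLp_injective 2 (Prod.ext ?_ ?_)
  · change (opX g hθ X₀ (shift f)).fst = (opT hθ T₀ Y₀ (opX g hθ X₀ f)).fst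
    rw [opX_fst, opT_fst, opY_opX hθ hYX, shift_mulOp]
  · change (opX g hθ X₀ (shift f)).snd = (opT hθ T₀ Y₀ (opX g hθ X₀ f)).snd
    rw [opX_snd, opT_snd, opX_snd, ← hθ.modelOp_projModel]
    exact DFunLike.congr_fun hX _

theorem opY_opT (hY : Y₀ ∘L T₀ = θ.modelOp ∘L Y₀) (w : DirectSumSpace θ H₀) :
    opY θ Y₀ (opT hθ T₀ Y₀ w) = shift (opY θ Y₀ w) := by
  have h1 : Y₀ (T₀ w.snd) = θ.modelOp (Y₀ w.snd) := DFunLike.congr_fun hY _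
  have h2 : θ.modelOp (Y₀ w.snd) = θ.projModel (shift (opY θ Y₀ w)) := by
    rw [← θ.projModel_coe (Y₀ w.snd), hθ.modelOp_projModel, opY_apply, map_add, map_add,
      HInf.projModel_of_mem_range (HInf.shift_mem_range (Subtype.prop _)), zero_add]
  rw [opY_apply, opT_fst, opT_snd, h1, h2, hθ.projRange_add_projModel]

theorem norm_opX_mulOp (u : H2) : ‖opX g hθ X₀ (θ.mulOp u)‖ = ‖g.mulOp (θ.mulOp u)‖ := by
  have h1 : (opX g hθ X₀ (θ.mulOp u)).snd = 0 := by
    rw [opX_snd, HInf.projModel_of_mem_range (θ.mulOp_apply_mem_range u), map_zero]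
  have h2 : ‖(opX g hθ X₀ (θ.mulOp u)).fst‖ = ‖g.mulOp (θ.mulOp u)‖ := by
    rw [opX_fst, Submodule.coe_norm,
      hθ.projRange_of_mem (g.mulOp_mem_range θ _ (θ.mulOp_apply_mem_range u))]
  rw [WithLp.prod_norm_eq_of_L2, h1, h2, norm_zero]
  simp

/-- `Y` is bounded below on `X ω H²`. -/
theorem exists_norm_opX_le {ω η h : HInf} (hω : ω.IsInner)
    (hid : ∀ z ∈ ball (0 : ℂ) 1, ω z = g z * η z + θ z * h z)
    (hYX : IsHInfCalculus g θ.modelOp (Y₀ ∘L X₀)) :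
    ∃ C : ℝ, ∀ x ∈ ω.range.map (opX g hθ X₀).toLinearMap, ‖x‖ ≤ C * ‖opY θ Y₀ x‖ := by
  -- The two summands bound `Xη(gf)` and `Xθ(hf)` in terms of `‖gf‖`, after `g` has been commuted
  -- next to `f`.
  refine ⟨‖opX g hθ X₀ ∘L η.mulOp‖ + ‖θ.mulOp ∘L h.mulOp‖, ?_⟩
  rintro _ ⟨_, ⟨f, rfl⟩, rfl⟩
  change ‖opX g hθ X₀ (ω.mulOp f)‖ ≤ _ * ‖opY θ Y₀ (opX g hθ X₀ (ω.mulOp f))‖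
  rw [opY_opX hθ hYX, HInf.mulOp_comm g ω]
  have h1 : opX g hθ X₀ (ω.mulOp f) =
      (opX g hθ X₀ ∘L η.mulOp) (g.mulOp f) + opX g hθ X₀ (θ.mulOp (h.mulOp f)) := by
    rw [HInf.mulOp_eq_add hid, map_add, ContinuousLinearMap.comp_apply, HInf.mulOp_comm g η]
  have h2 : g.mulOp (θ.mulOp (h.mulOp f)) = (θ.mulOp ∘L h.mulOp) (g.mulOp f) := by
    rw [HInf.mulOp_comm g θ, HInf.mulOp_comm g h, ContinuousLinearMap.comp_apply]
  calc ‖opX g hθ X₀ (ω.mulOp f)‖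
      ≤ ‖opX g hθ X₀ ∘L η.mulOp‖ * ‖g.mulOp f‖ + ‖θ.mulOp ∘L h.mulOp‖ * ‖g.mulOp f‖ := by
        rw [h1]
        refine (norm_add_le _ _).trans (add_le_add (ContinuousLinearMap.le_opNorm _ _) ?_)
        rw [norm_opX_mulOp, h2]
        exact ContinuousLinearMap.le_opNorm _ _
    _ = (‖opX g hθ X₀ ∘L η.mulOp‖ + ‖θ.mulOp ∘L h.mulOp‖) * ‖g.mulOp f‖ := by ring
    _ ≤ _ := mul_le_mul_of_nonneg_left (hω.norm_le _) (by positivity)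

end Operators

/-! ### Outer functions -/

theorem re_circleAverage_kernel {φ : ℂ → ℝ} (hφ : CircleIntegrable φ 0 1) {z : ℂ}
    (hz : z ∈ ball (0 : ℂ) 1) :
    (Real.circleAverage (fun ζ => (ζ + z) / (ζ - z) * (φ ζ : ℂ)) 0 1).re =
      Real.circleAverage (fun ζ => (herglotzRieszKernel 0 z ζ).re * φ ζ) 0 1 := by
  simpa [herglotzRieszKernel_def, Function.comp_def, Pi.mul_def] using
    re_circleAverage_herglotzRieszKernel_smul hφ hz

theorem circleIntegrable_re_kernel_mul {φ : ℂ → ℝ} (hφ : CircleIntegrable φ 0 1) {z : ℂ}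
    (hz : z ∈ ball (0 : ℂ) 1) :
    CircleIntegrable (fun ζ => (herglotzRieszKernel 0 z ζ).re * φ ζ) 0 1 :=
  hφ.continuousOn_smul
    (Complex.continuous_re.comp_continuousOn (continuousOn_herglotzRieszKernel_sphere hz))

/-- The real part of the kernel is the Poisson kernel, which is nonnegative. -/
theorem re_circleAverage_kernel_le {φ ψ : ℂ → ℝ} (hφ : CircleIntegrable φ 0 1)
    (hψ : CircleIntegrable ψ 0 1) (h : ∀ ζ, φ ζ ≤ ψ ζ) {z : ℂ} (hz : z ∈ ball (0 : ℂ) 1) :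
    (Real.circleAverage (fun ζ => (ζ + z) / (ζ - z) * (φ ζ : ℂ)) 0 1).re ≤
      (Real.circleAverage (fun ζ => (ζ + z) / (ζ - z) * (ψ ζ : ℂ)) 0 1).re := by
  rw [re_circleAverage_kernel hφ hz, re_circleAverage_kernel hψ hz]
  refine Real.circleAverage_mono (circleIntegrable_re_kernel_mul hφ hz)
    (circleIntegrable_re_kernel_mul hψ hz) fun ζ hζ => ?_
  refine mul_le_mul_of_nonneg_left (h ζ) ?_
  have h1 := le_re_herglotzRieszKernel (c := 0) (by simpa using hζ) hz
  have h2 := mem_ball_zero_iff.1 hz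
  refine le_trans ?_ h1
  rw [sub_zero]
  exact div_nonneg (by linarith) (by linarith [norm_nonneg z])

/-- The Poisson kernel has mean one. With monotonicity, this turns `φ ≤ a` into the bound `exp a`
for the modulus of the exponential. -/
theorem re_circleAverage_kernel_const (a : ℝ) {z : ℂ} (hz : z ∈ ball (0 : ℂ) 1) :
    (Real.circleAverage (fun ζ => (ζ + z) / (ζ - z) * (a : ℂ)) 0 1).re = a := by
  have h := (diffContOnCl_const (𝕜 := ℂ) (s := ball (0 : ℂ) 1)
    (c := (a : ℂ))).circleAverage_re_herglotzRieszKernel_smul hz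
  have h2 := re_circleAverage_kernel (φ := fun _ => a) (circleIntegrable_const a 0 1) hz
  rw [h2]
  have h3 := Complex.ofRealCLM.circleAverage_comp_comm
    (circleIntegrable_re_kernel_mul (circleIntegrable_const a 0 1) hz)
  rw [← Complex.ofReal_inj, ← h]
  refine h3.symm.trans ?_
  congr 1
  ext ζ
  simp

/-- The outer function with boundary modulus `exp φ`, for `φ` bounded above. -/
def outerOfBounded {φ : ℂ → ℝ} (hφ : CircleIntegrable φ 0 1) {a : ℝ} (ha : ∀ ζ, φ ζ ≤ a) :
    HInf where
  toFun z := Complex.exp (Real.circleAverage (fun ζ => (ζ + z) / (ζ - z) * (φ ζ : ℂ)) 0 1)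
  differentiableOn := by
    have h : CircleIntegrable (fun ζ => (φ ζ : ℂ)) 0 1 := by
      simp only [CircleIntegrable, intervalIntegrable_iff] at hφ ⊢
      exact Complex.ofRealCLM.integrable_comp hφ
    have := differentiableOn_circleAverage_herglotzRieszKernel_smul h
    simp only [herglotzRieszKernel_def, sub_zero, smul_eq_mul] at this
    exact this.cexp
  bounded := by
    refine ⟨Real.exp a, fun z hz => ?_⟩
    rw [Complex.norm_exp, Real.exp_le_exp, ← re_circleAverage_kernel_const a hz]
    exact re_circleAverage_kernel_le hφ (circleIntegrable_const a 0 1) ha hz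

theorem circleIntegrable_kernel_mul {φ : ℂ → ℝ} (hφ : CircleIntegrable φ 0 1) {z : ℂ}
    (hz : z ∈ ball (0 : ℂ) 1) :
    CircleIntegrable (fun ζ => (ζ + z) / (ζ - z) * (φ ζ : ℂ)) 0 1 := by
  have h : CircleIntegrable (fun ζ => (φ ζ : ℂ)) 0 1 := by
    simp only [CircleIntegrable, intervalIntegrable_iff] at hφ ⊢
    exact Complex.ofRealCLM.integrable_comp hφ
  have := h.continuousOn_smul (continuousOn_herglotzRieszKernel_sphere (c := 0) hz)
  simpa [herglotzRieszKernel_fun_def, Pi.mul_def] using this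

/-- If `F` is outer, then the closure of `F H²` contains the constants. -/
theorem HInf.IsOuter.one_mem_closure_range {F : HInf} (hF : F.IsOuter) :
    H2.one ∈ F.range.topologicalClosure := by
  obtain ⟨c, hc, φ, hφ, hFφ⟩ := hF
  have hint : ∀ n : ℕ, CircleIntegrable (fun ζ => -max (φ ζ) (-(n : ℝ))) 0 1 := fun n =>
    (show IntervalIntegrable _ _ _ _ from
      ⟨hφ.1.sup (circleIntegrable_const (-(n : ℝ)) 0 1).1,
        hφ.2.sup (circleIntegrable_const (-(n : ℝ)) 0 1).2⟩).neg
  have hint' : ∀ n : ℕ, CircleIntegrable (fun ζ => min (φ ζ + n) 0) 0 1 := by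
    intro n
    have := hφ.add (hint n)
    refine (circleIntegrable_congr fun ζ _ => ?_).1 this
    change φ ζ + -max (φ ζ) (-(n : ℝ)) = _
    rcases le_total (φ ζ) (-n) with h | h
    · rw [max_eq_right h, min_eq_left (by linarith)]; ring
    · rw [max_eq_left h, min_eq_right (by linarith)]; ring
  -- `Q n` is a bounded truncation of `1 / F`: the exponent of `F * Q n` has density `φ - max φ (-n)
  -- = min (φ + n) 0`, which is nonpositive and tends to `0`. So `F * Q n` is bounded by `1`, and
  -- its value at `0` tends to `c`.
  let Q : ℕ → HInf := fun n => outerOfBounded (hint n) (a := n) fun ζ => by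
    have := le_max_right (φ ζ) (-(n : ℝ)); linarith
  have hprod : ∀ n, ∀ z ∈ ball (0 : ℂ) 1, (F * Q n) z = c * Complex.exp
      (Real.circleAverage (fun ζ => (ζ + z) / (ζ - z) * ((min (φ ζ + n) 0 : ℝ) : ℂ)) 0 1) := by
    intro n z hz
    change F z * Complex.exp _ = _
    rw [hFφ z hz, mul_assoc, ← Complex.exp_add, ← Real.circleAverage_fun_add
      (circleIntegrable_kernel_mul hφ hz) (circleIntegrable_kernel_mul (hint n) hz)]
    congr 4
    ext ζ
    rw [← mul_add, ← Complex.ofReal_add]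
    congr 2
    rcases le_total (φ ζ) (-n) with h | h
    · rw [max_eq_right h, min_eq_left (by linarith)]; ring
    · rw [max_eq_left h, min_eq_right (by linarith)]; ring
  have hle : ∀ n, ∀ z ∈ ball (0 : ℂ) 1, ‖(F * Q n) z‖ ≤ 1 := by
    intro n z hz
    rw [hprod n z hz, norm_mul, hc, one_mul, Complex.norm_exp, Real.exp_le_one_iff]
    have := re_circleAverage_kernel_le (hint' n) (circleIntegrable_const (0 : ℝ) 0 1)
      (fun ζ => min_le_right _ _) hz
    rwa [re_circleAverage_kernel_const 0 hz] at this
  have h0 : (0 : ℂ) ∈ ball (0 : ℂ) 1 := by simp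
  have hlim : Tendsto (fun n => (F * Q n) 0) atTop (𝓝 c) := by
    have h1 : Tendsto (fun n : ℕ => Real.circleAverage
        (fun ζ => (ζ + 0) / (ζ - 0) * ((min (φ ζ + n) 0 : ℝ) : ℂ)) 0 1) atTop (𝓝 0) := by
      have h2 : Real.circleAverage (fun _ => (0 : ℂ)) 0 1 = 0 := by simp [Real.circleAverage_def]
      suffices h : Tendsto (fun n : ℕ => Real.circleAverage
          (fun ζ => (ζ + 0) / (ζ - 0) * ((min (φ ζ + n) 0 : ℝ) : ℂ)) 0 1) atTop
          (𝓝 (Real.circleAverage (fun _ => (0 : ℂ)) 0 1)) by rwa [h2] at h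
      simp only [Real.circleAverage_def]
      refine Tendsto.const_smul ?_ _
      refine intervalIntegral.tendsto_integral_filter_of_dominated_convergence
        (fun t => ‖φ (circleMap 0 1 t)‖) ?_ ?_ hφ.norm ?_
      · exact Eventually.of_forall fun n =>
          (intervalIntegrable_iff.1 (circleIntegrable_kernel_mul (hint' n) h0)).aestronglyMeasurable
      · refine Eventually.of_forall fun n => Eventually.of_forall fun t _ => ?_
        have hne : circleMap 0 1 t ≠ 0 := circleMap_ne_center one_ne_zero
        rw [add_zero, sub_zero, div_self hne, one_mul, Complex.norm_real, Real.norm_eq_abs,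
          Real.norm_eq_abs, abs_of_nonpos (min_le_right _ _)]
        have hn : (0 : ℝ) ≤ n := n.cast_nonneg
        rcases le_total (φ (circleMap 0 1 t) + n) 0 with h | h
        · rw [min_eq_left h, abs_of_nonpos (by linarith)]; linarith [neg_abs_le (φ (circleMap 0 1 t))]
        · rw [min_eq_right h, neg_zero]; exact abs_nonneg _
      · refine Eventually.of_forall fun t _ => tendsto_const_nhds.congr' ?_
        filter_upwards [eventually_ge_atTop ⌈-φ (circleMap 0 1 t)⌉₊] with n hn
        have := Nat.ceil_le.1 hn
        rw [min_eq_right (by linarith)]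
        simp
    have h3 := (h1.cexp).const_mul c
    rw [Complex.exp_zero, mul_one] at h3
    exact h3.congr fun n => (hprod n 0 h0).symm
  have hcoeff : ∀ n, (F * Q n).mulOp H2.one 0 = (F * Q n) 0 := by
    intro n
    have h1 := (F * Q n).hasSum_taylor (z := 0) (by simp)
    have h2 := hasSum_single (f := fun k => PowerSeries.coeff k (F * Q n).taylor * (0 : ℂ) ^ k) 0
      fun k hk => by simp [hk]
    rw [HInf.mulOp_apply, H2.taylor_one, mul_one, h1.unique h2]
    simp
  -- Expanding the square, both vectors have norm at most `1` and their inner product sees only the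
  -- value at `0`. Convergence at the single point `0` thus gives convergence in `H²`.
  have hdist : ∀ n, ‖(F * Q n).mulOp H2.one - c • H2.one‖ ^ 2 ≤
      2 - 2 * (starRingEnd ℂ c * (F * Q n) 0).re := by
    intro n
    have h1 : ‖(F * Q n).mulOp H2.one‖ ≤ 1 := by
      simpa [H2.norm_one] using HInf.norm_mulOp_le _ (hle n) H2.one
    have h2 : inner ℂ (c • H2.one) ((F * Q n).mulOp H2.one) = starRingEnd ℂ c * (F * Q n) 0 := by
      rw [inner_smul_left, ← hcoeff n]
      congr 1
      rw [H2.one, lp.inner_single_left]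
      simp
    have h3 : ‖c • H2.one‖ = 1 := by rw [norm_smul, hc, H2.norm_one, one_mul]
    rw [norm_sub_rev, norm_sub_sq (𝕜 := ℂ), h2, h3]
    have : ‖(F * Q n).mulOp H2.one‖ ^ 2 ≤ 1 := pow_le_one₀ (norm_nonneg _) h1
    change 1 ^ 2 - 2 * (starRingEnd ℂ c * (F * Q n) 0).re + _ ≤ _
    linarith
  have hcc : starRingEnd ℂ c * c = 1 := by
    rw [mul_comm, Complex.mul_conj, Complex.normSq_eq_norm_sq, hc]; simp
  have hto : Tendsto (fun n => (F * Q n).mulOp H2.one) atTop (𝓝 (c • H2.one)) := by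
    rw [tendsto_iff_norm_sub_tendsto_zero]
    have h1 : Tendsto (fun n => 2 - 2 * (starRingEnd ℂ c * (F * Q n) 0).re) atTop (𝓝 0) := by
      have := ((Complex.continuous_re.tendsto _).comp
        (hlim.const_mul (starRingEnd ℂ c))).const_mul 2 |>.const_sub 2
      simpa [hcc] using this
    have h2 := squeeze_zero (fun n => sq_nonneg _) hdist h1
    have h3 := h2.sqrt
    simpa [Real.sqrt_sq] using h3
  have hmem : c • H2.one ∈ F.range.topologicalClosure := by
    refine mem_closure_of_tendsto hto (Eventually.of_forall fun n => ?_)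
    rw [HInf.mulOp_mul]
    exact ⟨_, rfl⟩
  have := F.range.topologicalClosure.smul_mem (starRingEnd ℂ c) hmem
  rwa [smul_smul, hcc, one_smul] at this

/-- A closed shift-invariant subspace containing the constants is all of `H²`. -/
theorem eq_top_of_one_mem {N : Submodule ℂ H2} (hN : IsClosed (N : Set H2))
    (hS : ∀ y ∈ N, shift y ∈ N) (h1 : H2.one ∈ N) : N = ⊤ := by
  have : CompleteSpace N := hN.completeSpace_coe
  rw [← Submodule.orthogonal_eq_bot_iff, Submodule.eq_bot_iff]
  intro y hy
  have hpow : ∀ n, (shift ^ n) H2.one ∈ N := by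
    intro n
    induction n with
    | zero => simpa using h1
    | succ n ih =>
      rw [pow_succ', mul_apply_eq_comp]
      exact hS _ ih
  -- Orthogonality to `zⁿ` says that the `n`-th coefficient of `y` is zero.
  refine lp.ext (funext fun n => ?_)
  have h := hy _ (hpow n)
  rwa [shift_pow_one, lp.inner_single_left, RCLike.inner_apply, map_one, mul_one] at h

/-- An outer function is cyclic for the shift. -/
theorem HInf.IsOuter.closure_range_eq_top {F : HInf} (hF : F.IsOuter) :
    F.range.topologicalClosure = ⊤ :=
  eq_top_of_one_mem (Submodule.isClosed_topologicalClosure _)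
    (fun _ hy => F.shift_mem_closure_range hy) hF.one_mem_closure_range

theorem HInf.IsInner.mul {θ₁ θ₂ : HInf} (h₁ : θ₁.IsInner) (h₂ : θ₂.IsInner) :
    (θ₁ * θ₂).IsInner := by
  filter_upwards [h₁, h₂] with t ht₁ ht₂
  have := ht₁.mul ht₂
  rw [one_mul] at this
  exact this.congr fun r => (norm_mul _ _).symm

/-- If `F` is outer and `θ` is inner, then the closure of `θ F H²` is `θ H²`. -/
theorem HInf.IsOuter.closure_range_mul {F θ : HInf} (hF : F.IsOuter) (hθ : θ.IsInner) :
    (θ * F).range.topologicalClosure = θ.range := by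
  refine le_antisymm (Submodule.topologicalClosure_minimal _ ?_ hθ.isClosed_range) ?_
  · rintro _ ⟨f, rfl⟩
    exact ⟨F.mulOp f, ((θ.mulOp_mul F f)).symm⟩
  · rintro _ ⟨f, rfl⟩
    have hf : f ∈ F.range.topologicalClosure := hF.closure_range_eq_top ▸ Submodule.mem_top
    refine map_mem_closure θ.mulOp.continuous hf ?_
    rintro _ ⟨u, rfl⟩
    exact ⟨u, θ.mulOp_mul F u⟩

end

/-! ### Similarity of the restriction of `T` to the shift -/

theorem theorem2p4 (g η h θ ω : HInf) (hg : ∃ z ∈ Metric.ball (0 : ℂ) 1, g z ≠ 0)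
    (hθ : θ.IsInner) (hω : ω.IsInner)
    (hid : ∀ z ∈ Metric.ball (0 : ℂ) 1, ω z = g z * η z + θ z * h z)
    {H₀ : Type*} [NormedAddCommGroup H₀] [InnerProductSpace ℂ H₀] [CompleteSpace H₀]
    (T₀ : H₀ →L[ℂ] H₀) (X₀ : θ.model →L[ℂ] H₀) (Y₀ : H₀ →L[ℂ] θ.model)
    (hYX : IsHInfCalculus g θ.modelOp (Y₀ ∘L X₀))
    (hX : X₀ ∘L θ.modelOp = T₀ ∘L X₀) (hY : Y₀ ∘L T₀ = θ.modelOp ∘L Y₀)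
    (X : H2 →L[ℂ] DirectSumSpace θ H₀) (hXdef : X = opX g hθ X₀)
    (Y : DirectSumSpace θ H₀ →L[ℂ] H2) (hYdef : Y = opY θ Y₀)
    (T : DirectSumSpace θ H₀ →L[ℂ] DirectSumSpace θ H₀) (hTdef : T = opT hθ T₀ Y₀)
    (M : Submodule ℂ (DirectSumSpace θ H₀))
    (hMdef : M = (ω.range.map X.toLinearMap).topologicalClosure) :
    (∃ hM : ∀ x ∈ M, T x ∈ M, OpSimilar (T.restrict hM) shift) ∧
    (∀ ϑ : HInf, ϑ.IsInnerFactor g → M.map Y.toLinearMap = (ϑ * ω).range) ∧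
    X ∘L shift = T ∘L X ∧ Y ∘L T = shift ∘L Y ∧
    Y ∘L X = g.mulOp ∧ IsHInfCalculus g shift (Y ∘L X) := by
  have hXS : ∀ f, X (shift f) = T (X f) := by
    subst hXdef hTdef; exact opX_shift hθ hYX hX
  have hYT : ∀ w, Y (T w) = shift (Y w) := by
    subst hYdef hTdef; exact opY_opT hθ hY
  have hYXg : ∀ f, Y (X f) = g.mulOp f := by
    subst hXdef hYdef; exact opY_opX hθ hYX
  have hYXeq : Y ∘L X = g.mulOp := ContinuousLinearMap.ext hYXg
  -- This makes `θH² ⊕ H₀` complete, as the closed range argument for `Y` on `M` requires.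
  have : CompleteSpace θ.range := hθ.isClosed_range.completeSpace_coe
  obtain ⟨C, hC⟩ : ∃ C : ℝ, ∀ x ∈ ω.range.map X.toLinearMap, ‖x‖ ≤ C * ‖Y x‖ := by
    subst hXdef hYdef; exact exists_norm_opX_le hθ hω hid hYX
  have hrange : (ω.range.map X.toLinearMap).map Y.toLinearMap = (g * ω).range := by
    ext y
    constructor
    · rintro ⟨_, ⟨_, ⟨f, rfl⟩, rfl⟩, rfl⟩
      exact ⟨f, (g.mulOp_mul ω f).trans (hYXg _).symm⟩
    · rintro ⟨f, rfl⟩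
      exact ⟨_, ⟨_, ⟨f, rfl⟩, rfl⟩, (hYXg _).trans (g.mulOp_mul ω f).symm⟩
  have hMmap : M.map Y.toLinearMap = (g * ω).range.topologicalClosure := by
    rw [hMdef, map_topologicalClosure_eq Y hC, hrange]
  have hM : ∀ x ∈ M, T x ∈ M := by
    intro x hx
    rw [hMdef] at hx ⊢
    refine map_mem_closure T.continuous hx ?_
    rintro _ ⟨f, hf, rfl⟩
    exact ⟨shift f, HInf.var.mulOp_mem_range ω f hf, hXS f⟩
  -- Multiplication by the inner function `ω` is injective and `g` is not identically zero. This
  -- excludes the zero subspace, on which `S` would not be a shift.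
  have hone : (g * ω).mulOp H2.one ≠ 0 := by
    rw [HInf.mulOp_mul, HInf.mulOp_comm]
    intro h0
    obtain ⟨z, hz, hgz⟩ := hg
    have := congrArg (fun f => H2.eval f z) (hω.eq_zero_of_mulOp_eq_zero h0)
    simp only [HInf.eval_mulOp _ _ hz, H2.eval_one hz, mul_one] at this
    exact hgz (by simpa [H2.eval] using this)
  refine ⟨⟨hM, ?_⟩, fun ϑ hϑ => ?_, ContinuousLinearMap.ext hXS, ContinuousLinearMap.ext hYT,
    hYXeq, hYXeq ▸ g.isHInfCalculus_shift⟩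
  -- `Z₁` is `Y` from `M` onto the closure of `gωH²`, and `Z₂` identifies `S` on that closure with
  -- `S` on `H²`.
  · obtain ⟨Z₁, hZ₁⟩ := exists_equiv_of_norm_le
      (hMdef ▸ Submodule.isClosed_topologicalClosure _) (Submodule.isClosed_topologicalClosure _)
      Y hMmap (by rw [hMdef]; exact norm_le_of_mem_topologicalClosure Y hC)
    obtain ⟨Z₂, hZ₂⟩ := (g * ω).exists_equiv_closure_range hone
    refine ⟨Z₁.trans Z₂, fun x => ?_⟩
    have h1 : Z₁ (T.restrict hM x) =
        ⟨shift (Z₁ x), (g * ω).shift_mem_closure_range (Z₁ x).2⟩ := by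
      refine Subtype.ext ?_
      change (Z₁ (T.restrict hM x) : H2) = shift (Z₁ x)
      rw [hZ₁, hZ₁]
      exact hYT x
    change Z₂ (Z₁ (T.restrict hM x)) = shift (Z₂ (Z₁ x))
    rw [h1, hZ₂]
  · obtain ⟨hϑi, F, hF, hgF⟩ := hϑ
    rw [hMmap, ← hF.closure_range_mul (hϑi.mul hω)]
    congr 1
    have : (g * ω).mulOp = ((ϑ * ω) * F).mulOp := by
      ext1 f
      rw [HInf.mulOp_mul, HInf.mulOp_mul, HInf.mulOp_mul, HInf.mulOp_eq_of_eq_mul hgF,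
        HInf.mulOp_comm F ω]
    rw [HInf.range, HInf.range, this]
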